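/- Conventions. The universe $\mathcal U$ is any totally ordered set. For an input of $n$ items from $\mathcal U$ (with multiplicity) and $y\in\mathcal U$, the rank $R(y)$ is the number of input items $x\le y$. A *comparison-based sketch* keeps in memory a list of integers and a list of input items; it is a randomized algorithm with three operations (insert one more item; merge two sketches, using fresh independent randomness; answer a rank query $y$ by an estimate $\hat R(y)$ computed from the memory), in which items of $\mathcal U$ can only be compared, kept, copied and dropped. Its size is the number of stored items and integers (memory words). Write $\log$ for $\log_2$, $L=\log(\max(\varepsilon n,4))$ (that is, $L=\log(\varepsilon n)$ as soon as $\varepsilon n\ge 4$) and $LL=\log L$. **Theorem.** For all $0<\delta\le 1/2$ and $0<\varepsilon\le 1$ there is a randomized, comparison-based, one-pass, mergeable sketch, which depends on $\varepsilon$ and $\delta$ only (neither on $\mathcal U$ nor on the input size), with the following properties. Let a summary $S$ be built from the empty summary by an arbitrary sequence (tree) of insertions and pairwise merges, for instance by processing a stream with insertions only; let $n$ be the total number of items summarized by $S$, and suppose that $\varepsilon\cdot(2\log n)^{1/4}\le 4$ (for $n = 0$ this condition is regarded as satisfied). Then: 1. For every fixed $y\in\mathcal U$, the estimate $\hat R(y)$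 derived from $S$ satisfies $$\Pr\big[\,|\hat R(y)-R(y)|\ge \varepsilon R(y)\,\big]<\delta \text{ if } R(y)>0,\qquad \Pr\big[\,|\hat R(y)-R(y)|> \varepsilon R(y)\,\big]<\delta \text{ in any case,}$$ where the probability is over the internal randomness of the sketch. 2. Every integer stored in $S$ has $O(\log (n+2))$ bits, with an absolute constant. 3. For every constant $c>0$ there is a constant $C$, depending on $c$ only, such that for every outcome of the random choices: if $\varepsilon\le c\cdot LL\cdot\sqrt{\log(1/\delta)/L}$, then the size of $S$ is at most $$C\cdot \frac1\varepsilon\cdot L^{1.5}\cdot\sqrt{\log(1/\delta)}\cdot LL\,;$$ otherwise the size of $S$ is at most $C\cdot L^2$. -/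

import Mathlib

open scoped ENNReal

universe u

noncomputable section

namespace RelQuantile

/-- The outcomes of all comparisons among the items of a list: entry `(i, j)` tells whether the
`i`-th item is at most the `j`-th one. -/
def orderPattern {U : Type*} [LinearOrder U] (l : List U) :
    Fin l.length → Fin l.length → Bool :=
  fun i j => decide (l.get i ≤ l.get j)

/-- A randomized, comparison-based, one-pass quantile sketch with an update and a merge operation.

The memory of the sketch consists of a list of integers and a list of universe items. The
description of the sketch does not mention the universe at all: items can be compared, kept,
copied and dropped, and nothing else. Each operation on items is told only how many items are at
hand and how they compare with each other; it returns (at random) the new list of integers and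
the positions of the items that it keeps.

* `update a m p`: a new item arrives. Position `0` is the new item, the positions after it are
  the stored items; `a` is the list of stored integers.
* `merge a b m₁ m p`: two sketches are merged. The first `m₁` positions are the items of the first
  sketch, the others those of the second; `a` and `b` are the two lists of stored integers.
* `estimate a m p`: the estimated rank of a query item. Position `0` is the query item, the
  positions after it are the stored items. -/
structure Sketch where
  init : List ℕ
  update : List ℕ → (m : ℕ) → (Fin m → Fin m → Bool) → PMF (List ℕ × List (Fin m))
  merge : List ℕ → List ℕ → ℕ → (m : ℕ) → (Fin m → Fin m → Bool) →
    PMF (List ℕ × List (Fin m))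
  estimate : List ℕ → (m : ℕ) → (Fin m → Fin m → Bool) → ℝ

/-- The memory contents of a sketch over the universe `U`, that is, a summary. -/
structure Summary (U : Type*) where
  ints : List ℕ
  items : List U

/-- The size of a summary in memory words: every stored item and every stored integer takes one
word. -/
def Summary.size {U : Type*} (s : Summary U) : ℕ :=
  s.items.length + s.ints.length

/-- The summary whose items are those of `l` at the returned positions. -/
def Summary.ofPositions {U : Type*} (l : List U) (r : List ℕ × List (Fin l.length)) :
    Summary U :=
  ⟨r.1, r.2.map l.get⟩

/-- A way in which a summary is built: start with an empty summary, feed one more item to a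
summary, or merge two summaries (each built in an arbitrary way). A data stream that is processed
in one pass is a history without merges. -/
inductive History (U : Type*) where
  | empty : History U
  | insert (t : History U) (x : U) : History U
  | merge (t₁ t₂ : History U) : History U

namespace History

variable {U : Type*}

/-- The combined input of a history. -/
def input : History U → List U
  | empty => []
  | insert t x => t.input ++ [x]
  | merge t₁ t₂ => t₁.input ++ t₂.input

/-- The size `n` of the combined input. -/
def card (t : History U) : ℕ := t.input.length

/-- The rank of `y`: the number of input items `x ≤ y`, with multiplicity. -/
def rank [LinearOrder U] (t : History U) (y : U) : ℕ :=
  t.input.countP (fun x => decide (x ≤ y))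

end History

namespace Sketch

variable {U : Type*} [LinearOrder U] (A : Sketch)

/-- Feed the item `x` to a summary. -/
def insertItem (s : Summary U) (x : U) : PMF (Summary U) :=
  (A.update s.ints (x :: s.items).length (orderPattern (x :: s.items))).map
    (Summary.ofPositions (x :: s.items))

/-- Merge two summaries. -/
def mergeSummaries (s t : Summary U) : PMF (Summary U) :=
  (A.merge s.ints t.ints s.items.length (s.items ++ t.items).length
    (orderPattern (s.items ++ t.items))).map (Summary.ofPositions (s.items ++ t.items))

/-- The estimated rank of `y` that is derived from a summary. -/
def estimateRank (s : Summary U) (y : U) : ℝ :=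
  A.estimate s.ints (y :: s.items).length (orderPattern (y :: s.items))

/-- The law of the summary that is built along a history; all operations use independent
randomness. -/
def run : History U → PMF (Summary U)
  | .empty => PMF.pure ⟨A.init, []⟩
  | .insert t x => (run t).bind fun s => A.insertItem s x
  | .merge t₁ t₂ => (run t₁).bind fun s₁ => (run t₂).bind fun s₂ => A.mergeSummaries s₁ s₂

end Sketch

/-- The probability of an event under a discrete law. -/
def prob {α : Type*} (p : PMF α) (E : Set α) : ℝ≥0∞ := p.toOuterMeasure E

/-- The standing assumptions `0 < δ ≤ 1/2`, `0 < ε ≤ 1` and `ε ≤ 4 / (2 log₂ n)^(1/4)`; the last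
one is multiplied out, so that it is void for `n = 1`. -/
def Admissible (ε δ : ℝ) (n : ℕ) : Prop :=
  0 < δ ∧ δ ≤ 1 / 2 ∧ 0 < ε ∧ ε ≤ 1 ∧ ε * (2 * Real.logb 2 n) ^ (1 / 4 : ℝ) ≤ 4

/-- `log (ε n)`, to base two and bounded away from `log 1 = 0`. -/
def lg (ε : ℝ) (n : ℕ) : ℝ := Real.logb 2 (max (ε * n) 4)

/-- `log log (ε n)`. -/
def lglg (ε : ℝ) (n : ℕ) : ℝ := Real.logb 2 (lg ε n)

end RelQuantile

end

/-!
The sketch is a tower of relative compactors. Level `h` holds a buffer of items of weight `2 ^ h`.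
When a buffer overflows, it is sorted, its smallest items are kept, and among an even number of its
largest items every other one, chosen by a fair coin, is promoted to level `h + 1`. A compaction adds
the unbiased error `± 2 ^ h` to the estimated rank of `y` if it affects an odd number of *relevant*
items, those at most `y`, and no error otherwise. How far a compaction reaches
down is dictated by a counter: if it has `z` trailing ones, the top `z + 1` sections are cleared.
Two summaries are merged by concatenating buffers, by combining counters with bitwise `or`, and by
compacting all levels from the bottom to the top; an insertion is a merge with a summary of one item.

*Accuracy.* An exponential potential, taken along the tree of insertions and merges, yields both
tails at once. A relevant item at level `h` contributes its weight `± lam * 2 ^ h` plus a small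
surplus to the exponent. A compaction that affects relevant items costs a variance term of at most
`2 * lam ^ 2 * 4 ^ h`. It is not paid for at once. It leaves a section full of relevant items behind,
marked by a digit of the counter, and when this section is cleared, its items pay with part of their
surplus: this is the notion `Schedule.debt`, whose laws are `debt_compact_of_lt` for
compactions and `debt_merge` for merges. Hence the expected potential is at most one factor for each
relevant input item (`IsPotential.expect_runState_le`), and Markov's inequality gives
`prob_error_le`. Only levels with `2 ^ h * prot < 2 * R`, where `R` is the rank of `y`, may need
payment. A compaction at a higher level reaches relevant items only if they alone account for a
twofold overestimate, and this is an event of the upper tail: the upper potential is capped there, the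
lower one vanishes.

*Growth.* The number `n` of items is not known in advance. A summary of size class `i`, where
`ε n ≤ 2 ^ 4 ^ i`, uses `3 * 4 ^ i` sections of width about
`8 * (i + 1) * √(log (1 / δ)) / (ε * 2 ^ i)`. Each class has its own share in the surplus of an item.
A class that is left releases its share, which settles the debts incurred in it
(`exponent_anti`). The shares are summable because of the factor `i + 1` (`totalShare_le`); this
factor is the `log log` in the space bound. Since `4 ^ i` is of the order of `log (ε n)`, which also
bounds the number of levels, the size is at most a constant times
`ε⁻¹ * L ^ 1.5 * √(log (1 / δ)) * log L + L ^ 2` (`size_le`), and the case distinction only tells which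
of the two terms dominates.
-/

namespace RelQuantile

/-! ### The sketch -/

/-- The size schedule of a sketch: a summary of `n` items works in the size class `cls n`, and in
class `i` the sections of a compactor have `width i + 1` items. -/
structure Schedule where
  cls : ℕ → ℕ
  width : ℕ → ℕ

namespace Schedule

variable (S : Schedule)

/-- The number of items in a section. It exceeds `width` by one since a compaction may have to
leave one item of its lowest section behind, for the sake of parity. -/
def sec (i : ℕ) : ℕ := S.width i + 1

/-- The number of sections of a compactor in class `i`. -/
def numSec (i : ℕ) : ℕ := 3 * 4 ^ i

/-- The number of smallest items of a buffer that are never compacted. -/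
def prot (i : ℕ) : ℕ := 3 * (numSec i * S.sec i)

/-- The capacity of a buffer: the protected part and all the sections. -/
def cap (i : ℕ) : ℕ := S.prot i + numSec i * S.sec i

/-- The number of items that survive a compaction with counter `C`, up to parity: the compaction
clears `z + 1` sections, where `z` is the number of trailing ones of `C`. -/
def cut (i C : ℕ) : ℕ := S.prot i + (numSec i - 1 - padicValNat 2 (C + 1)) * S.sec i

end Schedule

/-- A relative compactor: a buffer of items together with a counter, whose binary digits tell
which sections have been left full by past compactions. -/
@[ext] structure Compactor (α : Type*) where
  ctr : ℕ
  buf : List α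

/-- The memory of the sketch in structured form: the number of items summarized and a list of
compactors; an item in the compactor number `h` stands for `2 ^ h` input items. -/
@[ext] structure State (α : Type*) where
  count : ℕ
  levels : List (Compactor α)

variable {α β : Type*}

/-- Every other element of a list, starting with the first one (`true`) or the second one
(`false`). -/
def everyOther : Bool → List α → List α
  | _, [] => []
  | true, x :: l => x :: everyOther false l
  | false, _ :: l => everyOther true l

/-- One compactor at work. If the buffer exceeds the capacity, an even number of its largest items
is removed, and every other one of them is promoted; the coin `b` selects which ones. -/
def compactLevel (S : Schedule) (le : α → α → Bool) (i : ℕ) (b : Bool) (l : Compactor α) :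
    Compactor α × List α :=
  if l.buf.length ≤ S.cap i then (l, [])
  else
    let q := S.cut i l.ctr + (l.buf.length - S.cut i l.ctr) % 2
    let sorted := l.buf.mergeSort le
    (⟨l.ctr + 1, sorted.take q⟩, everyOther b (sorted.drop q))

/-- A fair coin. -/
noncomputable def coin : PMF Bool := PMF.uniformOfFintype Bool

/-- The new topmost compactor that receives the items `c`, if there are any. -/
def topLevel (c : List α) : List (Compactor α) :=
  if c.isEmpty then [] else [⟨0, c⟩]

/-- Compaction of all levels from the bottom to the top; `c` is the list of items that are promoted
to the lowest of the levels. Above the last level, at most two new ones are needed. -/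
noncomputable def compactFrom (S : Schedule) (le : α → α → Bool) (i : ℕ) :
    List α → List (Compactor α) → PMF (List (Compactor α))
  | c, [] =>
    if c.isEmpty then PMF.pure [] else
      coin.map fun b =>
        (compactLevel S le i b ⟨0, c⟩).1 :: topLevel (compactLevel S le i b ⟨0, c⟩).2
  | c, l :: ls =>
    coin.bind fun b =>
      (compactFrom S le i (compactLevel S le i b ⟨l.ctr, l.buf ++ c⟩).2 ls).map fun r =>
        (compactLevel S le i b ⟨l.ctr, l.buf ++ c⟩).1 :: r

/-- Level-wise union: buffers are concatenated and counters are combined by bitwise `or`. -/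
def zipLevels : List (Compactor α) → List (Compactor α) → List (Compactor α)
  | [], ls => ls
  | l :: ls, [] => l :: ls
  | l :: ls, l' :: ls' => ⟨l.ctr ||| l'.ctr, l.buf ++ l'.buf⟩ :: zipLevels ls ls'

/-- The merge operation. -/
noncomputable def mergeStates (S : Schedule) (le : α → α → Bool) (s t : State α) :
    PMF (State α) :=
  (compactFrom S le (S.cls (s.count + t.count)) [] (zipLevels s.levels t.levels)).map
    (State.mk (s.count + t.count))

/-- The state that summarizes one item. -/
def single (x : α) : State α := ⟨1, [⟨0, [x]⟩]⟩

/-- The weighted number of stored items with a given property, each item of the compactor number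
`h` having weight `2 ^ h`. -/
def weightedCount (p : α → Bool) : List (Compactor α) → ℕ
  | [] => 0
  | l :: ls => l.buf.countP p + 2 * weightedCount p ls

/-! ### The memory layout -/

/-- The stored integers: the number of items, then counter and buffer length of each level. -/
def State.ints (s : State α) : List ℕ :=
  s.count :: s.levels.flatMap fun l => [l.ctr, l.buf.length]

/-- The stored items: all buffers, one after the other. -/
def State.items (s : State α) : List α := s.levels.flatMap Compactor.buf

/-- The levels are recovered from the stored integers and items. -/
def decodeLevels : List ℕ → List α → List (Compactor α)
  | c :: m :: a, xs => ⟨c, xs.take m⟩ :: decodeLevels a (xs.drop m)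
  | _, _ => []

/-- The state is recovered from the stored integers and items. -/
def decode : List ℕ → List α → State α
  | [], _ => ⟨0, []⟩
  | n :: a, xs => ⟨n, decodeLevels a xs⟩

/-- The sketch with a given schedule. -/
noncomputable def sketchOf (S : Schedule) : Sketch where
  init := [0]
  update a m p :=
    match List.finRange m with
    | [] => PMF.pure ([], [])
    | x :: xs => (mergeStates S p (decode a xs) (single x)).map fun s => (s.ints, s.items)
  merge a b m₁ m p :=
    (mergeStates S p (decode a ((List.finRange m).take m₁))
      (decode b ((List.finRange m).drop m₁))).map fun s => (s.ints, s.items)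
  estimate a m p :=
    match List.finRange m with
    | [] => 0
    | y :: xs => (weightedCount (fun x => p x y) (decode a xs).levels : ℕ)

theorem decode_encode (s : State α) : decode s.ints s.items = s := by
  obtain ⟨n, ls⟩ := s
  simp only [State.ints, State.items, decode, State.mk.injEq, true_and]
  induction ls with
  | nil => rfl
  | cons l ls ih => simp [decodeLevels, ih]

/-! ### Operations on positions and on items -/

/-- Relabelling of the items of a compactor. -/
def Compactor.map (f : α → β) (l : Compactor α) : Compactor β := ⟨l.ctr, l.buf.map f⟩

/-- Relabelling of the items of a state. -/
def State.map (f : α → β) (s : State α) : State β := ⟨s.count, s.levels.map (Compactor.map f)⟩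

theorem decodeLevels_map (f : α → β) (a : List ℕ) (xs : List α) :
    decodeLevels a (xs.map f) = (decodeLevels a xs).map (Compactor.map f) := by
  fun_induction decodeLevels a xs with
  | case1 c m a xs ih =>
    rw [decodeLevels, ← List.map_take, ← List.map_drop, ih]; rfl
  | case2 a xs h =>
    unfold decodeLevels
    split
    · exact absurd rfl (h _ _ _)
    · rfl

theorem decode_map (f : α → β) (a : List ℕ) (xs : List α) :
    decode a (xs.map f) = (decode a xs).map f := by
  cases a with
  | nil => rfl
  | cons n a => simp [decode, State.map, decodeLevels_map]

theorem everyOther_map (f : α → β) (b : Bool) (l : List α) :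
    everyOther b (l.map f) = (everyOther b l).map f := by
  fun_induction everyOther b l <;> simp_all [everyOther]

theorem compactLevel_map (S : Schedule) {le : α → α → Bool} {le' : β → β → Bool} {f : α → β}
    (hf : ∀ a b, le a b = le' (f a) (f b)) (i : ℕ) (b : Bool) (l : Compactor α) :
    compactLevel S le' i b (l.map f) =
      ((compactLevel S le i b l).1.map f, (compactLevel S le i b l).2.map f) := by
  have hs : (l.buf.map f).mergeSort le' = (l.buf.mergeSort le).map f :=
    (List.map_mergeSort fun a _ b _ => hf a b).symm
  unfold compactLevel
  simp only [Compactor.map, List.length_map, hs, ← List.map_take, ← List.map_drop, everyOther_map]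
  split_ifs <;> simp

theorem topLevel_map (f : α → β) (c : List α) :
    topLevel (c.map f) = (topLevel c).map (Compactor.map f) := by
  cases c <;> simp [topLevel, Compactor.map]

theorem compactFrom_map (S : Schedule) {le : α → α → Bool} {le' : β → β → Bool} {f : α → β}
    (hf : ∀ a b, le a b = le' (f a) (f b)) (i : ℕ) (ls : List (Compactor α)) (c : List α) :
    compactFrom S le' i (c.map f) (ls.map (Compactor.map f)) =
      (compactFrom S le i c ls).map (List.map (Compactor.map f)) := by
  induction ls generalizing c with
  | nil =>
    simp only [List.map_nil, compactFrom, List.isEmpty_iff, List.map_eq_nil_iff]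
    split_ifs with h
    · simp [PMF.pure_map]
    · rw [PMF.map_comp]
      congr 1
      funext b
      have := compactLevel_map S hf i b ⟨0, c⟩
      simp only [Compactor.map] at this
      simp [this, topLevel_map, Compactor.map]
  | cons l ls ih =>
    simp only [List.map_cons, compactFrom, PMF.map_bind]
    congr 1
    funext b
    have := compactLevel_map S hf i b ⟨l.ctr, l.buf ++ c⟩
    simp only [Compactor.map, List.map_append] at this
    simp only [Compactor.map]
    rw [this]
    simp only [ih, PMF.map_comp]
    congr 1

theorem zipLevels_map (f : α → β) (ls ls' : List (Compactor α)) :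
    zipLevels (ls.map (Compactor.map f)) (ls'.map (Compactor.map f)) =
      (zipLevels ls ls').map (Compactor.map f) := by
  fun_induction zipLevels ls ls' <;> simp_all [zipLevels, Compactor.map]

/-- The merge operation commutes with relabellings that respect the comparisons: it depends on the
order pattern of the items only. -/
theorem mergeStates_map (S : Schedule) {le : α → α → Bool} {le' : β → β → Bool} {f : α → β}
    (hf : ∀ a b, le a b = le' (f a) (f b)) (s t : State α) :
    mergeStates S le' (s.map f) (t.map f) = (mergeStates S le s t).map (State.map f) := by
  have := compactFrom_map S hf (S.cls (s.count + t.count)) (zipLevels s.levels t.levels) []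
  rw [List.map_nil] at this
  simp only [mergeStates, State.map, zipLevels_map, this, PMF.map_comp]
  rfl

theorem State.items_map (f : α → β) (s : State α) : (s.map f).items = s.items.map f := by
  simp [State.items, State.map, Compactor.map, List.map_flatMap, List.flatMap_map]

theorem State.ints_map (f : α → β) (s : State α) : (s.map f).ints = s.ints := by
  simp [State.ints, State.map, Compactor.map, List.flatMap_map]

theorem weightedCount_map (f : α → β) (p : β → Bool) (ls : List (Compactor α)) :
    weightedCount p (ls.map (Compactor.map f)) = weightedCount (p ∘ f) ls := by
  induction ls with
  | nil => rfl
  | cons l ls ih => simp [weightedCount, ih, Compactor.map, List.countP_map]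

/-- The summary that stores a given state. -/
def State.toSummary (s : State α) : Summary α := ⟨s.ints, s.items⟩

theorem ofPositions_state (l : List α) (s : State (Fin l.length)) :
    Summary.ofPositions l (s.ints, s.items) = (s.map l.get).toSummary := by
  simp only [Summary.ofPositions, State.toSummary, State.ints_map, State.items_map]

section Run

variable {U : Type*} [LinearOrder U]

/-- The order of the universe as a Boolean relation. -/
def leB (x y : U) : Bool := decide (x ≤ y)

/-- The law of the state that is built along a history. -/
noncomputable def runState (S : Schedule) : History U → PMF (State U)
  | .empty => PMF.pure ⟨0, []⟩
  | .insert t x => (runState S t).bind fun s => mergeStates S leB s (single x)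
  | .merge t₁ t₂ => (runState S t₁).bind fun s₁ => (runState S t₂).bind fun s₂ =>
      mergeStates S leB s₁ s₂

theorem orderPattern_eq (l : List U) (i j : Fin l.length) :
    orderPattern l i j = leB (l.get i) (l.get j) := rfl

theorem insertItem_toSummary (S : Schedule) (s : State U) (x : U) :
    (sketchOf S).insertItem s.toSummary x =
      (mergeStates S leB s (single x)).map State.toSummary := by
  have h1 : s = (decode s.ints ((List.finRange s.items.length).map Fin.succ)).map
      (x :: s.items).get := by
    rw [← decode_map, List.map_map]
    have : ((x :: s.items).get ∘ Fin.succ) = s.items.get := by funext i; rfl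
    rw [this, List.map_get_finRange, decode_encode]
  have h2 : single x = (single (0 : Fin (x :: s.items).length)).map (x :: s.items).get := rfl
  conv_rhs => rw [h1, h2, mergeStates_map S (orderPattern_eq (x :: s.items))]
  simp only [Sketch.insertItem, sketchOf, State.toSummary]
  rw [show List.finRange (x :: s.items).length =
    (0 : Fin (x :: s.items).length) :: (List.finRange s.items.length).map Fin.succ from
      List.finRange_succ]
  simp only [PMF.map_comp]
  congr 1
  funext r
  exact ofPositions_state _ r

theorem mergeSummaries_toSummary (S : Schedule) (s t : State U) :
    (sketchOf S).mergeSummaries s.toSummary t.toSummary =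
      (mergeStates S leB s t).map State.toSummary := by
  have h0 := List.map_get_finRange (s.items ++ t.items)
  have h1 : s = (decode s.ints ((List.finRange (s.items ++ t.items).length).take
      s.items.length)).map (s.items ++ t.items).get := by
    rw [← decode_map, List.map_take, h0, List.take_left, decode_encode]
  have h2 : t = (decode t.ints ((List.finRange (s.items ++ t.items).length).drop
      s.items.length)).map (s.items ++ t.items).get := by
    rw [← decode_map, List.map_drop, h0, List.drop_left, decode_encode]
  have h3 := mergeStates_map S (orderPattern_eq (s.items ++ t.items))
    (decode s.ints ((List.finRange (s.items ++ t.items).length).take s.items.length))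
    (decode t.ints ((List.finRange (s.items ++ t.items).length).drop s.items.length))
  rw [← h1, ← h2] at h3
  rw [h3]
  simp only [Sketch.mergeSummaries, sketchOf, State.toSummary]
  simp only [PMF.map_comp]
  congr 1
  funext r
  exact ofPositions_state _ r

theorem estimateRank_toSummary (S : Schedule) (s : State U) (y : U) :
    (sketchOf S).estimateRank s.toSummary y =
      (weightedCount (fun x => leB x y) s.levels : ℕ) := by
  have h1 : s = (decode s.ints ((List.finRange s.items.length).map Fin.succ)).map
      (y :: s.items).get := by
    rw [← decode_map, List.map_map]
    have : ((y :: s.items).get ∘ Fin.succ) = s.items.get := by funext i; rfl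
    rw [this, List.map_get_finRange, decode_encode]
  conv_rhs => rw [h1]
  simp only [Sketch.estimateRank, sketchOf, State.toSummary, State.map, weightedCount_map]
  rw [show List.finRange (y :: s.items).length =
    (0 : Fin (y :: s.items).length) :: (List.finRange s.items.length).map Fin.succ from
      List.finRange_succ]
  rfl

/-- The run of the sketch is the run on states, written to memory. -/
theorem run_eq_map_runState (S : Schedule) (t : History U) :
    (sketchOf S).run t = (runState S t).map State.toSummary := by
  induction t with
  | empty => simp [Sketch.run, runState, PMF.pure_map, State.toSummary, State.ints, State.items,
      sketchOf]
  | insert t x ih =>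
    simp only [Sketch.run, runState, ih, PMF.bind_map, PMF.map_bind, Function.comp_def,
      insertItem_toSummary]
  | merge t₁ t₂ ih₁ ih₂ =>
    simp only [Sketch.run, runState, ih₁, ih₂, PMF.bind_map, PMF.map_bind, Function.comp_def,
      mergeSummaries_toSummary]

end Run

/-! ### One compaction -/

theorem mem_of_mem_everyOther {b : Bool} {l : List α} {x : α} (h : x ∈ everyOther b l) :
    x ∈ l := by
  fun_induction everyOther b l <;> grind

/-- In a list in which the elements with the property `p` come first, every other one of them is
chosen. -/
theorem countP_everyOther (p : α → Bool) (b : Bool) {l : List α}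
    (h : l.Pairwise fun x y => p y → p x) :
    (everyOther b l).countP p = (l.countP p + if b then 1 else 0) / 2 := by
  fun_induction everyOther b l with
  | case1 b => cases b <;> simp
  | case2 x l ih =>
    obtain ⟨h1, h2⟩ := List.pairwise_cons.1 h
    specialize ih h2
    by_cases hx : p x
    · simp only [List.countP_cons_of_pos hx, ih]
      simp
      omega
    · have : l.countP p = 0 := List.countP_eq_zero.2 fun a ha hpa => hx (h1 a ha hpa)
      simp [hx, ih, this]
  | case3 x l ih =>
    obtain ⟨h1, h2⟩ := List.pairwise_cons.1 h
    specialize ih h2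
    by_cases hx : p x
    · simp [List.countP_cons_of_pos hx, ih]
    · have : l.countP p = 0 := List.countP_eq_zero.2 fun a ha hpa => hx (h1 a ha hpa)
      simp [hx, ih, this]

theorem length_everyOther (b : Bool) (l : List α) :
    (everyOther b l).length = (l.length + if b then 1 else 0) / 2 := by
  have := countP_everyOther (fun _ : α => true) b (l := l)
    (List.pairwise_of_forall fun _ _ _ => rfl)
  simpa using this

/-- In a list in which the elements with the property `p` come first, they fill an initial
segment. -/
theorem countP_take_of_pairwise (p : α → Bool) (q : ℕ) {l : List α}
    (h : l.Pairwise fun x y => p y → p x) :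
    (l.take q).countP p = min (l.countP p) q := by
  induction l generalizing q with
  | nil => simp
  | cons x l ih =>
    obtain ⟨h1, h2⟩ := List.pairwise_cons.1 h
    cases q with
    | zero => simp
    | succ q =>
      by_cases hx : p x
      · simp [List.countP_cons_of_pos hx, ih q h2]
      · have h0 : l.countP p = 0 := List.countP_eq_zero.2 fun a ha hpa => hx (h1 a ha hpa)
        rw [List.take_succ_cons, List.countP_cons_of_neg hx, List.countP_cons_of_neg hx, ih q h2, h0]
        simp

namespace Schedule

variable (S : Schedule) (i : ℕ)

theorem cut_lt_cap (C : ℕ) : S.cut i C < S.cap i := by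
  unfold cut cap
  have h1 : 0 < numSec i := by unfold numSec; positivity
  have h2 : 0 < S.sec i := by unfold sec; positivity
  have := Nat.mul_lt_mul_of_pos_right
    (show numSec i - 1 - padicValNat 2 (C + 1) < numSec i by omega) h2
  omega

theorem prot_le_cut (C : ℕ) : S.prot i ≤ S.cut i C := by
  unfold cut; omega

end Schedule

/-- The numbers of items when a compaction takes place: `q` items stay, an even number of items
is compacted, at least `sec` of them. -/
theorem compactLevel_length (S : Schedule) (le : α → α → Bool) (i : ℕ) (b : Bool)
    (l : Compactor α) (h : S.cap i < l.buf.length) :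
    ∃ q, S.cut i l.ctr ≤ q ∧ q ≤ S.cut i l.ctr + 1 ∧
      (compactLevel S le i b l).1.ctr = l.ctr + 1 ∧
      (compactLevel S le i b l).1.buf.length = q ∧
      q + 2 * (compactLevel S le i b l).2.length = l.buf.length := by
  have hc := S.cut_lt_cap i l.ctr
  refine ⟨S.cut i l.ctr + (l.buf.length - S.cut i l.ctr) % 2, by omega, by omega, ?_⟩
  simp only [compactLevel, if_neg h.not_ge, List.length_take, List.length_mergeSort,
    length_everyOther, List.length_drop, true_and]
  refine ⟨by omega, ?_⟩
  cases b <;> simp <;> omega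

theorem compactLevel_of_le (S : Schedule) (le : α → α → Bool) (i : ℕ) (b : Bool)
    (l : Compactor α) (h : l.buf.length ≤ S.cap i) : compactLevel S le i b l = (l, []) := by
  simp [compactLevel, h]

/-- The numbers of items at most `y` when a compaction takes place. -/
theorem compactLevel_countP {U : Type*} [LinearOrder U] (S : Schedule) (i : ℕ)
    (l : Compactor U) (y : U) (h : S.cap i < l.buf.length) :
    ∃ q, S.cut i l.ctr ≤ q ∧ q ≤ S.cut i l.ctr + 1 ∧ ∀ b : Bool,
      (compactLevel S leB i b l).1.ctr = l.ctr + 1 ∧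
      (compactLevel S leB i b l).1.buf.countP (leB · y) = min (l.buf.countP (leB · y)) q ∧
      (compactLevel S leB i b l).2.countP (leB · y) =
        (l.buf.countP (leB · y) - q + if b then 1 else 0) / 2 := by
  refine ⟨S.cut i l.ctr + (l.buf.length - S.cut i l.ctr) % 2, by omega, by omega, fun b => ?_⟩
  simp only [compactLevel, if_neg h.not_ge, true_and]
  generalize S.cut i l.ctr + (l.buf.length - S.cut i l.ctr) % 2 = q
  have hperm : (l.buf.mergeSort leB).Perm l.buf := List.mergeSort_perm _ _
  have hsort : (l.buf.mergeSort leB).Pairwise fun x x' => leB x x' :=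
    List.pairwise_mergeSort (fun a b c => by simpa [leB] using le_trans)
      (fun a b => by simpa [leB] using le_total a b) _
  have hpre : (l.buf.mergeSort leB).Pairwise fun x x' => leB x' y → leB x y :=
    hsort.imp fun {a b} hab hb => by
      simp only [leB, decide_eq_true_eq] at *
      exact hab.trans hb
  have hcount := hperm.countP_eq (leB · y)
  have htake := countP_take_of_pairwise (leB · y) q hpre
  have hsplit := List.countP_append (p := (leB · y)) (l₁ := (l.buf.mergeSort leB).take q)
    (l₂ := (l.buf.mergeSort leB).drop q)
  rw [List.take_append_drop] at hsplit
  refine ⟨by rw [htake, hcount], ?_⟩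
  rw [countP_everyOther _ _ (hpre.sublist (List.drop_sublist _ _))]
  congr 2
  omega

theorem mem_compactLevel {S : Schedule} {le : α → α → Bool} {i : ℕ} {b : Bool}
    {l : Compactor α} {x : α}
    (h : x ∈ (compactLevel S le i b l).1.buf ∨ x ∈ (compactLevel S le i b l).2) : x ∈ l.buf := by
  unfold compactLevel at h
  split_ifs at h
  · simpa using h
  · rw [← List.mem_mergeSort (le := le)]
    rcases h with h | h
    · exact List.mem_of_mem_take h
    · exact List.mem_of_mem_drop (mem_of_mem_everyOther h)

/-! ### The debt of a compactor -/

/-- The digits of `C` and `C + 1` around the number `z` of trailing ones of `C`. -/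
theorem testBit_trailing (C b : ℕ) :
    (padicValNat 2 (C + 1) < b → (C + 1).testBit b = C.testBit b) ∧
      (b = padicValNat 2 (C + 1) → (C + 1).testBit b = true ∧ C.testBit b = false) := by
  set z := padicValNat 2 (C + 1) with hz
  obtain ⟨m, hm⟩ : 2 ^ z ∣ C + 1 := pow_padicValNat_dvd
  have hodd : m % 2 = 1 := by
    by_contra hne
    obtain ⟨k, rfl⟩ : 2 ∣ m := by omega
    refine pow_succ_padicValNat_not_dvd (p := 2) (n := C + 1) (by omega) ⟨k, ?_⟩
    rw [← hz, hm, pow_succ]; ring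
  obtain ⟨k, rfl⟩ : ∃ k, m = 2 * k + 1 := ⟨m / 2, by omega⟩
  have hpos : 0 < 2 ^ z := by positivity
  have h1 : C + 1 = 2 ^ z * (2 * k + 1) + 0 := by rw [hm, add_zero]
  have h2 : C = 2 ^ z * (2 * k) + (2 ^ z - 1) := by
    have : 2 ^ z * (2 * k + 1) = 2 ^ z * (2 * k) + 2 ^ z := by ring
    omega
  constructor
  · intro hb
    rw [h1, Nat.testBit_two_pow_mul_add _ hpos]
    conv_rhs => rw [h2, Nat.testBit_two_pow_mul_add _ (by omega)]
    rw [if_neg (by omega), if_neg (by omega)]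
    obtain ⟨j, hj⟩ : ∃ j, b - z = j + 1 := ⟨b - z - 1, by omega⟩
    rw [hj, Nat.testBit_succ, Nat.testBit_succ]
    congr 1
    omega
  · intro hb
    rw [hb]
    constructor
    · rw [h1, Nat.testBit_two_pow_mul_add _ hpos]
      simp
    · conv_lhs => rw [h2, Nat.testBit_two_pow_mul_add _ (by omega)]
      simp

namespace Schedule

variable (S : Schedule) (i : ℕ)

/-- The sections (numbered from the top) that are marked by a digit of `C` and that lie entirely
among the smallest `c` items of the buffer. -/
def marked (C c : ℕ) : Finset ℕ :=
  {b ∈ Finset.range (numSec i) | C.testBit b ∧ S.prot i + (numSec i - 1 - b) * S.sec i ≤ c}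

/-- The debt of a compactor with counter `C` and `c` relevant items. A compaction that affects
relevant items is not paid for at once, but marks a section that is full of relevant items; the
compaction that clears this section will pay `width` units, one for each item removed. Relevant
items above the capacity are in debt as well; they make up for marks that coincide when two
counters are merged. -/
def debt (C c : ℕ) : ℕ := S.width i * (S.marked i C c).card + (c - S.cap i)

theorem mem_marked {C c b : ℕ} : b ∈ S.marked i C c ↔
    b < numSec i ∧ C.testBit b ∧ S.prot i + (numSec i - 1 - b) * S.sec i ≤ c := by
  simp [marked]

theorem card_marked_le (C c : ℕ) : (S.marked i C c).card ≤ numSec i :=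
  (Finset.card_filter_le _ _).trans (by simp)

theorem width_mul_card_le (C c : ℕ) :
    S.width i * (S.marked i C c).card ≤ numSec i * S.sec i := by
  rw [mul_comm]
  exact Nat.mul_le_mul (S.card_marked_le i C c) (by simp [sec])

theorem debt_eq_zero {C c : ℕ} (h : c < S.prot i) : S.debt i C c = 0 := by
  have : S.marked i C c = ∅ := by
    ext b
    simp only [mem_marked, Finset.notMem_empty, iff_false]
    omega
  have hc : c ≤ S.cap i := by unfold cap; omega
  simp [debt, this, hc]

theorem marked_mono {C C' c c' : ℕ} (hC : ∀ b, C.testBit b → C'.testBit b) (h : c ≤ c') :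
    S.marked i C c ⊆ S.marked i C' c' := by
  intro b
  simp only [mem_marked]
  exact fun ⟨h1, h2, h3⟩ => ⟨h1, hC b h2, h3.trans h⟩

theorem debt_mono {C C' c c' : ℕ} (hC : ∀ b, C.testBit b → C'.testBit b) (h : c ≤ c') :
    S.debt i C c ≤ S.debt i C' c' := by
  unfold debt
  have := Nat.mul_le_mul_left (S.width i) (Finset.card_le_card (S.marked_mono i hC h))
  omega

theorem debt_le (C c : ℕ) : S.debt i C c ≤ c := by
  rcases lt_or_ge c (S.prot i) with h | h
  · simp [S.debt_eq_zero i h]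
  · have := S.width_mul_card_le i C c
    unfold debt cap at *
    unfold prot at *
    omega

/-- Debts are inherited when two compactors are merged. -/
theorem debt_merge (C C' c c' : ℕ) :
    S.debt i C c + S.debt i C' c' ≤ S.debt i (C ||| C') (c + c') := by
  rcases lt_or_ge c (S.prot i) with h | h
  · rw [S.debt_eq_zero i h, zero_add]
    exact S.debt_mono i (by simp +contextual) (by omega)
  rcases lt_or_ge c' (S.prot i) with h' | h'
  · rw [S.debt_eq_zero i h', add_zero]
    exact S.debt_mono i (by simp +contextual) (by omega)
  have h1 := S.width_mul_card_le i C c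
  have h2 := S.width_mul_card_le i C' c'
  unfold debt cap at *
  unfold prot at *
  omega

theorem padicValNat_lt {C : ℕ} (hC : C + 1 < 2 ^ numSec i) :
    padicValNat 2 (C + 1) < numSec i := by
  have h1 : 2 ^ padicValNat 2 (C + 1) ≤ C + 1 := Nat.le_of_dvd (by omega) pow_padicValNat_dvd
  exact (Nat.pow_lt_pow_iff_right (by norm_num)).1 (h1.trans_lt hC)

/-- A compaction that affects no relevant items does not diminish the debt. -/
theorem debt_compact_of_le (hw : 0 < S.width i) {C c : ℕ} (hC : C + 1 < 2 ^ numSec i)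
    (hc : c ≤ S.cut i C + 1) : S.debt i C c ≤ S.debt i (C + 1) c := by
  have hz := padicValNat_lt i hC
  unfold debt
  refine Nat.add_le_add_right (Nat.mul_le_mul_left _ (Finset.card_le_card fun b hb => ?_)) _
  rw [mem_marked] at hb ⊢
  obtain ⟨h1, h2, h3⟩ := hb
  refine ⟨h1, ?_, h3⟩
  rcases lt_trichotomy (padicValNat 2 (C + 1)) b with h | h | h
  · rw [(testBit_trailing C b).1 h, h2]
  · exact ((testBit_trailing C b).2 h.symm).1
  · -- a section above the cut starts at least two items beyond it
    exfalso
    have h4 : (numSec i - 1 - padicValNat 2 (C + 1) + 1) * S.sec i ≤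
        (numSec i - 1 - b) * S.sec i := Nat.mul_le_mul_right _ (by omega)
    unfold cut at hc
    have : S.sec i = S.width i + 1 := rfl
    rw [add_mul, one_mul] at h4
    omega

/-- A compaction that affects relevant items (`q < c`) raises the debt by `width`, after the items
removed have paid one unit each. -/
theorem debt_compact_of_lt {C c q : ℕ} (hC : C + 1 < 2 ^ numSec i) (hq : S.cut i C ≤ q)
    (hq' : q ≤ S.cut i C + 1) (hc : q < c) :
    S.debt i C c + S.width i ≤ (c - q) + S.debt i (C + 1) q := by
  have hz := padicValNat_lt i hC
  set z := padicValNat 2 (C + 1) with hzdef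
  set A := {b ∈ S.marked i C c | b < z} with hA
  set B := {b ∈ S.marked i C c | ¬ b < z} with hB
  have hAB : A.card + B.card = (S.marked i C c).card :=
    Finset.card_filter_add_card_filter_not _
  -- the marks below the cut persist, and a new one appears
  have hB' : B.card + 1 ≤ (S.marked i (C + 1) q).card := by
    have hzB : z ∉ B := by
      rw [hB, Finset.mem_filter, mem_marked]
      rintro ⟨⟨-, h, -⟩, -⟩
      rw [((testBit_trailing C z).2 hzdef).2] at h
      exact Bool.false_ne_true h
    rw [← Finset.card_insert_of_notMem hzB]
    refine Finset.card_le_card fun b hb => ?_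
    rw [mem_marked]
    rcases Finset.mem_insert.1 hb with h | hb
    · rw [h]
      exact ⟨hz, ((testBit_trailing C z).2 hzdef).1, hq⟩
    · have hzb : b ≠ z := fun h => hzB (h ▸ hb)
      rw [hB, Finset.mem_filter, mem_marked] at hb
      obtain ⟨⟨h1, h2, -⟩, h4⟩ := hb
      refine ⟨h1, by rw [(testBit_trailing C b).1 (by omega), h2], le_trans ?_ hq⟩
      exact Nat.add_le_add_left (Nat.mul_le_mul_right _ (by omega)) _
  -- the marks above the cut are cleared and paid by the items in their sections
  have hsec : S.sec i = S.width i + 1 := rfl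
  have hcap : S.cap i = S.cut i C + (z + 1) * S.sec i := by
    unfold cap cut
    rw [← hzdef, add_assoc, ← add_mul]
    congr 2
    omega
  have hAz : A.card ≤ z := by
    simpa using Finset.card_le_card (show A ⊆ Finset.range z from fun b hb => by
      rw [hA, Finset.mem_filter] at hb
      simpa using hb.2)
  have hAc : A.card * S.sec i ≤ c - S.cut i C := by
    have h1 : A ⊆ Finset.Ico (z - (c - S.cut i C) / S.sec i) z := by
      intro b hb
      rw [hA, Finset.mem_filter, mem_marked] at hb
      obtain ⟨⟨h1, -, h3⟩, h4⟩ := hb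
      have h5 : (z - b) * S.sec i ≤ c - S.cut i C := by
        have : (numSec i - 1 - b) * S.sec i =
            (numSec i - 1 - z) * S.sec i + (z - b) * S.sec i := by
          rw [← add_mul]
          congr 1
          omega
        unfold cut
        rw [← hzdef]
        omega
      have h6 := (Nat.le_div_iff_mul_le (by omega)).2 h5
      rw [Finset.mem_Ico]
      omega
    have h2 := Finset.card_le_card h1
    rw [Nat.card_Ico] at h2
    have h3 : ∀ D, z - (z - D) ≤ D := fun D => by omega
    exact (Nat.le_div_iff_mul_le (by omega)).1 (h2.trans (h3 _))
  have hpay : S.width i * A.card + (c - S.cap i) ≤ c - q := by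
    have e1 : A.card * S.sec i = S.width i * A.card + A.card := by rw [hsec]; ring
    have e2 : (z + 1) * S.sec i = S.width i * z + z + S.width i + 1 := by rw [hsec]; ring
    have e3 := Nat.mul_le_mul_left (S.width i) hAz
    rcases le_or_gt c (S.cap i) with h | h
    · rcases Nat.eq_zero_or_pos A.card with h0 | h0
      · simp [h0, h]
      · omega
    · omega
  have e4 := Nat.mul_le_mul_left (S.width i) hB'
  unfold debt
  rw [← hAB, mul_add] at *
  omega

end Schedule

/-! ### Invariants of the memory -/

/-- The properties of a schedule on which the analysis relies. The last one says that a counter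
never runs out of sections to mark. -/
structure Schedule.Regular (S : Schedule) : Prop where
  cls_mono : Monotone S.cls
  width_pos : ∀ i, 0 < S.width i
  width_anti : Antitone S.width
  prot_mono : Monotone S.prot
  ctr_lt : ∀ n C, S.sec (S.cls n) * C ≤ n → C + 1 < 2 ^ Schedule.numSec (S.cls n)

/-- The total weight of the stored items. -/
def weight (ls : List (Compactor α)) : ℕ := weightedCount (fun _ => true) ls

@[simp] theorem weight_nil : weight ([] : List (Compactor α)) = 0 := rfl

@[simp] theorem weight_cons (l : Compactor α) (ls : List (Compactor α)) :
    weight (l :: ls) = l.buf.length + 2 * weight ls := by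
  simp [weight, weightedCount]

/-- For each compaction recorded by a counter, at least `s / 2` items have been promoted; their
weight is found in the levels above. -/
def CtrOK (s : ℕ) : List (Compactor α) → Prop
  | [] => True
  | l :: ls => s * l.ctr ≤ 2 * weight ls ∧ CtrOK s ls

/-- All buffers but the topmost one have at least `m` items. -/
def FullOK (m : ℕ) : List (Compactor α) → Prop
  | [] => True
  | l :: ls => (ls ≠ [] → m ≤ l.buf.length) ∧ FullOK m ls

theorem mem_support_compactFrom_cons {S : Schedule} {le : α → α → Bool} {i : ℕ} {c : List α}
    {l : Compactor α} {ls r : List (Compactor α)}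
    (h : r ∈ (compactFrom S le i c (l :: ls)).support) :
    ∃ b, ∃ r' ∈ (compactFrom S le i (compactLevel S le i b ⟨l.ctr, l.buf ++ c⟩).2 ls).support,
      r = (compactLevel S le i b ⟨l.ctr, l.buf ++ c⟩).1 :: r' := by
  rw [compactFrom, PMF.mem_support_bind_iff] at h
  obtain ⟨b, -, hb⟩ := h
  rw [PMF.mem_support_map_iff] at hb
  obtain ⟨r', h1, h2⟩ := hb
  exact ⟨b, r', h1, h2.symm⟩

theorem mem_support_compactFrom_nil {S : Schedule} {le : α → α → Bool} {i : ℕ} {c : List α}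
    {r : List (Compactor α)} (h : r ∈ (compactFrom S le i c []).support) :
    (c = [] ∧ r = []) ∨ ∃ b, r = (compactLevel S le i b ⟨0, c⟩).1 ::
      topLevel (compactLevel S le i b ⟨0, c⟩).2 := by
  rw [compactFrom] at h
  split_ifs at h with hc
  · left
    simp_all
  · right
    rw [PMF.mem_support_map_iff] at h
    obtain ⟨b, -, hb⟩ := h
    exact ⟨b, hb.symm⟩

theorem weight_topLevel (c : List α) : weight (topLevel c) = c.length := by
  cases c <;> simp [topLevel]

theorem mem_topLevel {c : List α} {l : Compactor α} (h : l ∈ topLevel c) :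
    l = ⟨0, c⟩ ∧ c ≠ [] := by
  cases c <;> simp_all [topLevel]

theorem ctrOK_topLevel (s : ℕ) (c : List α) : CtrOK s (topLevel c) := by
  cases c <;> simp [topLevel, CtrOK]

theorem fullOK_topLevel (m : ℕ) (c : List α) : FullOK m (topLevel c) := by
  cases c <;> simp [topLevel, FullOK]

theorem compactLevel_weight (S : Schedule) (le : α → α → Bool) (i : ℕ) (b : Bool)
    (l : Compactor α) :
    (compactLevel S le i b l).1.buf.length + 2 * (compactLevel S le i b l).2.length =
      l.buf.length := by
  rcases le_or_gt l.buf.length (S.cap i) with h | h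
  · simp [compactLevel_of_le S le i b l h]
  · obtain ⟨q, -, -, -, h4, h5⟩ := compactLevel_length S le i b l h
    omega

theorem compactLevel_ctr (S : Schedule) (le : α → α → Bool) (i : ℕ) (b : Bool)
    (l : Compactor α) :
    S.sec i * (compactLevel S le i b l).1.ctr ≤
      S.sec i * l.ctr + 2 * (compactLevel S le i b l).2.length := by
  rcases le_or_gt l.buf.length (S.cap i) with h | h
  · simp [compactLevel_of_le S le i b l h]
  · obtain ⟨q, -, h2, h3, -, h5⟩ := compactLevel_length S le i b l h
    have h6 : S.cut i l.ctr + S.sec i ≤ S.cap i := by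
      have h1 : 0 < Schedule.numSec i := by unfold Schedule.numSec; positivity
      have := Nat.mul_le_mul_right (S.sec i) (show
        Schedule.numSec i - 1 - padicValNat 2 (l.ctr + 1) + 1 ≤ Schedule.numSec i by omega)
      rw [add_mul, one_mul] at this
      unfold Schedule.cut Schedule.cap
      omega
    rw [h3, mul_add, mul_one]
    omega

theorem compactLevel_full (S : Schedule) (le : α → α → Bool) (i : ℕ) (b : Bool)
    (l : Compactor α) {m : ℕ} (hm : m ≤ S.prot i)
    (h : m ≤ l.buf.length ∨ (compactLevel S le i b l).2 ≠ []) :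
    m ≤ (compactLevel S le i b l).1.buf.length := by
  rcases le_or_gt l.buf.length (S.cap i) with hl | hl
  · simpa [compactLevel_of_le S le i b l hl] using h
  · obtain ⟨q, h1, -, -, h4, -⟩ := compactLevel_length S le i b l hl
    have := S.prot_le_cut i l.ctr
    omega

theorem compactLevel_cap (S : Schedule) (le : α → α → Bool) (i : ℕ) (b : Bool)
    (l : Compactor α) : (compactLevel S le i b l).1.buf.length ≤ S.cap i := by
  rcases le_or_gt l.buf.length (S.cap i) with h | h
  · simpa [compactLevel_of_le S le i b l h] using h
  · obtain ⟨q, -, h2, -, h4, -⟩ := compactLevel_length S le i b l h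
    have := S.cut_lt_cap i l.ctr
    omega

theorem compactLevel_carry (S : Schedule) (le : α → α → Bool) (i : ℕ) (b : Bool)
    (l : Compactor α) (h : l.buf.length ≤ 4 * S.cap i) :
    (compactLevel S le i b l).2.length ≤ 2 * S.cap i := by
  have := compactLevel_weight S le i b l
  omega

theorem compactLevel_carry_top (S : Schedule) (le : α → α → Bool) (i : ℕ) (b : Bool)
    (l : Compactor α) (h : l.buf.length ≤ 2 * S.cap i) :
    (compactLevel S le i b l).2.length ≤ S.cap i := by
  have := compactLevel_weight S le i b l
  omega

section CompactFrom

variable {S : Schedule} {le : α → α → Bool} {i : ℕ} {c : List α} {ls r : List (Compactor α)}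

theorem weight_compactFrom (h : r ∈ (compactFrom S le i c ls).support) :
    weight r = c.length + weight ls := by
  induction ls generalizing c r with
  | nil =>
    rcases mem_support_compactFrom_nil h with ⟨rfl, rfl⟩ | ⟨b, rfl⟩
    · rfl
    · have := compactLevel_weight S le i b ⟨0, c⟩
      simp only [weight_cons, weight_topLevel, weight_nil] at *
      omega
  | cons l ls ih =>
    obtain ⟨b, r', hr', rfl⟩ := mem_support_compactFrom_cons h
    have h1 := ih hr'
    have := compactLevel_weight S le i b ⟨l.ctr, l.buf ++ c⟩
    simp only [weight_cons, List.length_append] at *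
    omega

theorem ctrOK_compactFrom (h : r ∈ (compactFrom S le i c ls).support)
    (hls : CtrOK (S.sec i) ls) : CtrOK (S.sec i) r := by
  induction ls generalizing c r with
  | nil =>
    rcases mem_support_compactFrom_nil h with ⟨rfl, rfl⟩ | ⟨b, rfl⟩
    · exact hls
    · refine ⟨?_, ctrOK_topLevel _ _⟩
      simpa [weight_topLevel] using compactLevel_ctr S le i b ⟨0, c⟩
  | cons l ls ih =>
    obtain ⟨b, r', hr', rfl⟩ := mem_support_compactFrom_cons h
    refine ⟨?_, ih hr' hls.2⟩
    have h1 := compactLevel_ctr S le i b ⟨l.ctr, l.buf ++ c⟩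
    have h2 := weight_compactFrom hr'
    have h3 := hls.1
    simp only at h1
    omega

theorem fullOK_compactFrom {m : ℕ} (hm : m ≤ S.prot i)
    (h : r ∈ (compactFrom S le i c ls).support) (hls : FullOK m ls) : FullOK m r := by
  induction ls generalizing c r with
  | nil =>
    rcases mem_support_compactFrom_nil h with ⟨rfl, rfl⟩ | ⟨b, rfl⟩
    · exact hls
    · refine ⟨fun hne => compactLevel_full S le i b _ hm (Or.inr fun h0 => hne ?_),
        fullOK_topLevel _ _⟩
      simp [h0, topLevel]
  | cons l ls ih =>
    obtain ⟨b, r', hr', rfl⟩ := mem_support_compactFrom_cons h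
    refine ⟨fun hne => compactLevel_full S le i b _ hm ?_, ih hr' hls.2⟩
    by_cases hl : ls = []
    · right
      intro h0
      subst hl
      rw [h0] at hr'
      simp [compactFrom] at hr'
      exact hne hr'
    · left
      have := hls.1 hl
      simp only [List.length_append]
      omega

theorem cap_compactFrom (h : r ∈ (compactFrom S le i c ls).support)
    (hc : c.length ≤ 2 * S.cap i) (hls : ∀ l ∈ ls, l.buf.length ≤ 2 * S.cap i) :
    ∀ l ∈ r, l.buf.length ≤ S.cap i := by
  induction ls generalizing c r with
  | nil =>
    rcases mem_support_compactFrom_nil h with ⟨rfl, rfl⟩ | ⟨b, rfl⟩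
    · simp
    · intro l hl
      rcases List.mem_cons.1 hl with rfl | hl
      · exact compactLevel_cap S le i b _
      · rw [(mem_topLevel hl).1]
        exact compactLevel_carry_top S le i b ⟨0, c⟩ hc
  | cons l ls ih =>
    obtain ⟨b, r', hr', rfl⟩ := mem_support_compactFrom_cons h
    intro l' hl'
    rcases List.mem_cons.1 hl' with rfl | hl'
    · exact compactLevel_cap S le i b _
    · refine ih hr' (compactLevel_carry S le i b _ ?_)
        (fun l hl => hls l (List.mem_cons_of_mem _ hl)) l' hl'
      have := hls l List.mem_cons_self
      simp only [List.length_append]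
      omega

theorem mem_compactFrom (h : r ∈ (compactFrom S le i c ls).support) {l : Compactor α} {x : α}
    (hl : l ∈ r) (hx : x ∈ l.buf) : x ∈ c ∨ ∃ l' ∈ ls, x ∈ l'.buf := by
  induction ls generalizing c r with
  | nil =>
    rcases mem_support_compactFrom_nil h with ⟨rfl, rfl⟩ | ⟨b, rfl⟩
    · simp at hl
    · left
      rcases List.mem_cons.1 hl with rfl | hl
      · exact mem_compactLevel (Or.inl hx)
      · rw [(mem_topLevel hl).1] at hx
        exact mem_compactLevel (Or.inr hx)
  | cons l' ls ih =>
    obtain ⟨b, r', hr', rfl⟩ := mem_support_compactFrom_cons h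
    have key : x ∈ l'.buf ++ c → x ∈ c ∨ ∃ l ∈ l' :: ls, x ∈ l.buf := by
      intro hx
      rcases List.mem_append.1 hx with hx | hx
      · exact Or.inr ⟨l', List.mem_cons_self, hx⟩
      · exact Or.inl hx
    rcases List.mem_cons.1 hl with rfl | hl
    · exact key (mem_compactLevel (Or.inl hx))
    · rcases ih hr' hl with h1 | ⟨l'', h1, h2⟩
      · exact key (mem_compactLevel (Or.inr h1))
      · exact Or.inr ⟨l'', List.mem_cons_of_mem _ h1, h2⟩

end CompactFrom

theorem weight_zipLevels (ls ls' : List (Compactor α)) :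
    weight (zipLevels ls ls') = weight ls + weight ls' := by
  fun_induction zipLevels ls ls' <;> simp_all
  omega

theorem CtrOK.mono {s s' : ℕ} (h : s' ≤ s) {ls : List (Compactor α)} (hls : CtrOK s ls) :
    CtrOK s' ls := by
  induction ls with
  | nil => trivial
  | cons l ls ih => exact ⟨(Nat.mul_le_mul_right _ h).trans hls.1, ih hls.2⟩

theorem or_le_add (m n : ℕ) : m ||| n ≤ m + n := by
  induction m using Nat.strong_induction_on generalizing n with
  | _ m ih =>
    rcases Nat.eq_zero_or_pos m with rfl | hm
    · simp
    · have h1 := ih (m / 2) (by omega) (n / 2)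
      rw [← Nat.or_div_two] at h1
      have h2 : (m ||| n) % 2 ≤ m % 2 + n % 2 := by
        have := Nat.or_mod_two_pow (a := m) (b := n) (n := 1)
        rw [pow_one] at this
        rw [this]
        rcases Nat.mod_two_eq_zero_or_one m with h | h <;>
          rcases Nat.mod_two_eq_zero_or_one n with h' | h' <;> simp [h, h']
      omega

theorem CtrOK.zip {s : ℕ} {ls ls' : List (Compactor α)} (h : CtrOK s ls) (h' : CtrOK s ls') :
    CtrOK s (zipLevels ls ls') := by
  fun_induction zipLevels ls ls' with
  | case1 ls => exact h'
  | case2 l ls => exact h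
  | case3 l ls l' ls' ih =>
    refine ⟨?_, ih h.2 h'.2⟩
    rw [weight_zipLevels]
    have h1 := h.1
    have h2 := h'.1
    have h3 : l.ctr ||| l'.ctr ≤ l.ctr + l'.ctr := or_le_add _ _
    have h4 := Nat.mul_le_mul_left s h3
    rw [mul_add] at h4
    simp only
    omega

theorem CtrOK.mul_ctr_le {s : ℕ} {ls : List (Compactor α)} (h : CtrOK s ls) :
    ∀ l ∈ ls, s * l.ctr ≤ weight ls := by
  induction ls with
  | nil => simp
  | cons l ls ih =>
    intro l' hl'
    rw [weight_cons]
    rcases List.mem_cons.1 hl' with rfl | hl'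
    · have := h.1
      omega
    · have := ih h.2 l' hl'
      omega

theorem FullOK.zip {m : ℕ} {ls ls' : List (Compactor α)} (h : FullOK m ls) (h' : FullOK m ls') :
    FullOK m (zipLevels ls ls') := by
  fun_induction zipLevels ls ls' with
  | case1 ls => exact h'
  | case2 l ls => exact h
  | case3 l ls l' ls' ih =>
    refine ⟨fun hne => ?_, ih h.2 h'.2⟩
    simp only [List.length_append]
    by_cases h1 : ls = []
    · have h2 : ls' ≠ [] := by
        rintro rfl
        simp [h1, zipLevels] at hne
      have := h'.1 h2
      omega
    · have := h.1 h1
      omega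

/-- The weights grow geometrically, so that there are only logarithmically many levels. -/
theorem FullOK.two_pow_mul_le {m : ℕ} {ls : List (Compactor α)} (h : FullOK m ls) :
    2 ^ (ls.length - 1) * m ≤ weight ls + m := by
  induction ls with
  | nil => simp
  | cons l ls ih =>
    rw [weight_cons, List.length_cons, Nat.add_sub_cancel]
    cases ls with
    | nil => simp
    | cons l' ls =>
      have h1 := h.1 (by simp)
      have h2 := ih h.2
      simp only [List.length_cons, Nat.add_sub_cancel] at h2 ⊢
      rw [pow_succ]
      nlinarith

theorem length_zipLevels_mem {m : ℕ} {ls ls' : List (Compactor α)}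
    (h : ∀ l ∈ ls, l.buf.length ≤ m) (h' : ∀ l ∈ ls', l.buf.length ≤ m) :
    ∀ l ∈ zipLevels ls ls', l.buf.length ≤ 2 * m := by
  fun_induction zipLevels ls ls' with
  | case1 ls => exact fun l hl => (h' l hl).trans (by omega)
  | case2 l ls => exact fun l hl => (h l hl).trans (by omega)
  | case3 l ls l' ls' ih =>
    simp only [List.mem_cons, forall_eq_or_imp, List.length_append] at h h' ⊢
    exact ⟨by omega, ih h.2 h'.2⟩

theorem mem_zipLevels {ls ls' : List (Compactor α)} {l : Compactor α} {x : α}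
    (hl : l ∈ zipLevels ls ls') (hx : x ∈ l.buf) :
    (∃ l' ∈ ls, x ∈ l'.buf) ∨ ∃ l' ∈ ls', x ∈ l'.buf := by
  fun_induction zipLevels ls ls' with
  | case1 ls => exact Or.inr ⟨l, hl, hx⟩
  | case2 l' ls => exact Or.inl ⟨l, hl, hx⟩
  | case3 l₁ ls l₂ ls' ih =>
    rcases List.mem_cons.1 hl with rfl | hl
    · rcases List.mem_append.1 hx with hx | hx
      · exact Or.inl ⟨l₁, List.mem_cons_self, hx⟩
      · exact Or.inr ⟨l₂, List.mem_cons_self, hx⟩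
    · rcases ih hl with ⟨l', h1, h2⟩ | ⟨l', h1, h2⟩
      · exact Or.inl ⟨l', List.mem_cons_of_mem _ h1, h2⟩
      · exact Or.inr ⟨l', List.mem_cons_of_mem _ h1, h2⟩

/-- The invariants of a summary of `n` items. -/
structure Invariant (S : Schedule) (n : ℕ) (s : State α) : Prop where
  count_eq : s.count = n
  weight_eq : weight s.levels = n
  ctr : CtrOK (S.sec (S.cls n)) s.levels
  full : FullOK (S.prot 0) s.levels
  cap : ∀ l ∈ s.levels, l.buf.length ≤ S.cap (S.cls n)

theorem invariant_empty (S : Schedule) : Invariant S 0 (⟨0, []⟩ : State α) :=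
  ⟨rfl, rfl, trivial, trivial, by simp⟩

theorem invariant_single (S : Schedule) (x : α) : Invariant S 1 (single x) := by
  refine ⟨rfl, rfl, ?_, ?_, ?_⟩
  · simp [single, CtrOK]
  · simp [single, FullOK]
  · have h1 : 0 < Schedule.numSec (S.cls 1) := by unfold Schedule.numSec; positivity
    have h2 : 0 < S.sec (S.cls 1) := by unfold Schedule.sec; positivity
    have := Nat.mul_pos h1 h2
    simp only [single, List.mem_singleton, forall_eq, List.length_singleton]
    unfold Schedule.cap
    omega

namespace Schedule.Regular

variable {S : Schedule} (hS : S.Regular)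
include hS

theorem cap_mono : Monotone S.cap := by
  intro i j hij
  have := hS.prot_mono hij
  unfold cap
  unfold prot at *
  omega

theorem sec_anti : Antitone S.sec := fun _ _ hij => Nat.add_le_add_right (hS.width_anti hij) 1

theorem ctrOK_zipLevels {n m : ℕ} {s t : State α} (hs : Invariant S n s)
    (ht : Invariant S m t) :
    CtrOK (S.sec (S.cls (n + m))) (zipLevels s.levels t.levels) :=
  (hs.ctr.mono (hS.sec_anti (hS.cls_mono (by omega)))).zip
    (ht.ctr.mono (hS.sec_anti (hS.cls_mono (by omega))))

theorem invariant_merge {le : α → α → Bool} {n m : ℕ} {s t r : State α} (hs : Invariant S n s)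
    (ht : Invariant S m t) (hr : r ∈ (mergeStates S le s t).support) :
    Invariant S (n + m) r := by
  rw [mergeStates, PMF.mem_support_map_iff, hs.count_eq, ht.count_eq] at hr
  obtain ⟨ls, hls, rfl⟩ := hr
  refine ⟨rfl, ?_, ctrOK_compactFrom hls (hS.ctrOK_zipLevels hs ht),
    fullOK_compactFrom (hS.prot_mono (Nat.zero_le _)) hls (hs.full.zip ht.full),
    cap_compactFrom hls (by simp) (length_zipLevels_mem ?_ ?_)⟩
  · rw [weight_compactFrom hls, weight_zipLevels, hs.weight_eq, ht.weight_eq]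
    simp
  · exact fun l hl => (hs.cap l hl).trans (hS.cap_mono (hS.cls_mono (by omega)))
  · exact fun l hl => (ht.cap l hl).trans (hS.cap_mono (hS.cls_mono (by omega)))

/-- No counter of two summaries that are being merged runs out of sections. -/
theorem ctr_lt_zipLevels {n m : ℕ} {s t : State α} (hs : Invariant S n s)
    (ht : Invariant S m t) : ∀ l ∈ zipLevels s.levels t.levels,
      l.ctr + 1 < 2 ^ numSec (S.cls (n + m)) := by
  intro l hl
  refine hS.ctr_lt _ _ (((hS.ctrOK_zipLevels hs ht).mul_ctr_le l hl).trans ?_)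
  rw [weight_zipLevels, hs.weight_eq, ht.weight_eq]

end Schedule.Regular

theorem card_insert (t : History α) (x : α) : (t.insert x).card = t.card + 1 := by
  simp [History.card, History.input]

theorem card_merge (t₁ t₂ : History α) : (t₁.merge t₂).card = t₁.card + t₂.card := by
  simp [History.card, History.input]

theorem mem_mergeStates {S : Schedule} {le : α → α → Bool} {s t r : State α}
    (hr : r ∈ (mergeStates S le s t).support) {l : Compactor α} {x : α} (hl : l ∈ r.levels)
    (hx : x ∈ l.buf) : (∃ l' ∈ s.levels, x ∈ l'.buf) ∨ ∃ l' ∈ t.levels, x ∈ l'.buf := by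
  rw [mergeStates, PMF.mem_support_map_iff] at hr
  obtain ⟨ls, hls, rfl⟩ := hr
  rcases mem_compactFrom hls hl hx with h | ⟨l', h1, h2⟩
  · simp at h
  · exact mem_zipLevels h1 h2

section Run

variable {U : Type*} [LinearOrder U]

theorem rank_insert (t : History U) (x y : U) :
    (t.insert x).rank y = t.rank y + if x ≤ y then 1 else 0 := by
  simp [History.rank, History.input, List.countP_append, List.countP_cons]

theorem rank_merge (t₁ t₂ : History U) (y : U) :
    (t₁.merge t₂).rank y = t₁.rank y + t₂.rank y := by
  simp [History.rank, History.input, List.countP_append]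

theorem invariant_runState {S : Schedule} (hS : S.Regular) (t : History U) {s : State U}
    (hs : s ∈ (runState S t).support) : Invariant S t.card s := by
  induction t generalizing s with
  | empty =>
    rw [runState, PMF.mem_support_pure_iff] at hs
    subst hs
    exact invariant_empty S
  | insert t x ih =>
    rw [runState, PMF.mem_support_bind_iff] at hs
    obtain ⟨s', h1, h2⟩ := hs
    rw [card_insert]
    exact hS.invariant_merge (ih h1) (invariant_single S x) h2
  | merge t₁ t₂ ih₁ ih₂ =>
    rw [runState, PMF.mem_support_bind_iff] at hs
    obtain ⟨s₁, h1, hs⟩ := hs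
    rw [PMF.mem_support_bind_iff] at hs
    obtain ⟨s₂, h2, h3⟩ := hs
    rw [card_merge]
    exact hS.invariant_merge (ih₁ h1) (ih₂ h2) h3

/-- Only input items are stored. -/
theorem mem_input_of_mem_levels {S : Schedule} (t : History U) {s : State U}
    (hs : s ∈ (runState S t).support) {l : Compactor U} {x : U} (hl : l ∈ s.levels)
    (hx : x ∈ l.buf) : x ∈ t.input := by
  induction t generalizing s l with
  | empty =>
    rw [runState, PMF.mem_support_pure_iff] at hs
    subst hs
    simp at hl
  | insert t y ih =>
    rw [runState, PMF.mem_support_bind_iff] at hs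
    obtain ⟨s', h1, h2⟩ := hs
    rw [History.input, List.mem_append]
    rcases mem_mergeStates h2 hl hx with ⟨l', h3, h4⟩ | ⟨l', h3, h4⟩
    · exact Or.inl (ih h1 h3 h4)
    · right
      simp only [single, List.mem_singleton] at h3
      subst h3
      exact h4
  | merge t₁ t₂ ih₁ ih₂ =>
    rw [runState, PMF.mem_support_bind_iff] at hs
    obtain ⟨s₁, h1, hs⟩ := hs
    rw [PMF.mem_support_bind_iff] at hs
    obtain ⟨s₂, h2, h3⟩ := hs
    rw [History.input, List.mem_append]
    rcases mem_mergeStates h3 hl hx with ⟨l', h4, h5⟩ | ⟨l', h4, h5⟩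
    · exact Or.inl (ih₁ h1 h4 h5)
    · exact Or.inr (ih₂ h2 h4 h5)

theorem weightedCount_eq_zero (p : α → Bool) {ls : List (Compactor α)}
    (h : ∀ l ∈ ls, ∀ x ∈ l.buf, p x = false) : weightedCount p ls = 0 := by
  induction ls with
  | nil => rfl
  | cons l ls ih =>
    simp only [List.mem_cons, forall_eq_or_imp] at h
    have : l.buf.countP p = 0 := List.countP_eq_zero.2 fun x hx => by simp [h.1 x hx]
    rw [weightedCount, this, ih h.2]

/-- Ranks that are zero are estimated correctly. -/
theorem weightedCount_eq_zero_of_rank_eq_zero {S : Schedule} (t : History U) {s : State U}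
    (hs : s ∈ (runState S t).support) {y : U} (hy : t.rank y = 0) :
    weightedCount (leB · y) s.levels = 0 := by
  refine weightedCount_eq_zero _ fun l hl x hx => ?_
  have h1 := mem_input_of_mem_levels t hs hl hx
  rw [History.rank, List.countP_eq_zero] at hy
  simpa [leB] using hy x h1

end Run

/-! ### Expectations under discrete laws -/

/-- The expectation of a nonnegative function under a discrete law. -/
noncomputable def expect (p : PMF α) (f : α → ℝ≥0∞) : ℝ≥0∞ := ∑' a, p a * f a

theorem expect_mono {p : PMF α} {f g : α → ℝ≥0∞} (h : ∀ a ∈ p.support, f a ≤ g a) :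
    expect p f ≤ expect p g := by
  refine ENNReal.tsum_le_tsum fun a => ?_
  by_cases ha : p a = 0
  · simp [ha]
  · gcongr
    exact h a ha

theorem expect_mul_left (p : PMF α) (c : ℝ≥0∞) (f : α → ℝ≥0∞) :
    expect p (fun a => c * f a) = c * expect p f := by
  simp only [expect, ← ENNReal.tsum_mul_left, mul_left_comm]

theorem expect_const (p : PMF α) (c : ℝ≥0∞) : expect p (fun _ => c) = c := by
  rw [expect, ENNReal.tsum_mul_right, p.tsum_coe, one_mul]

theorem expect_pure (a : α) (f : α → ℝ≥0∞) : expect (PMF.pure a) f = f a := by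
  rw [expect, tsum_eq_single a]
  · simp
  · intro b hb
    simp [hb]

theorem expect_bind (p : PMF α) (q : α → PMF β) (f : β → ℝ≥0∞) :
    expect (p.bind q) f = expect p fun a => expect (q a) f := by
  simp only [expect, PMF.bind_apply, ← ENNReal.tsum_mul_right, ← ENNReal.tsum_mul_left, mul_assoc]
  exact ENNReal.tsum_comm

theorem expect_map (p : PMF α) (g : α → β) (f : β → ℝ≥0∞) :
    expect (p.map g) f = expect p fun a => f (g a) := by
  rw [← PMF.bind_pure_comp, expect_bind]
  simp only [Function.comp_apply, expect_pure]

theorem expect_coin (f : Bool → ℝ≥0∞) : expect coin f = (f true + f false) / 2 := by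
  simp only [expect, coin, tsum_fintype, Fintype.sum_bool, PMF.uniformOfFintype_apply,
    Fintype.card_bool, ENNReal.div_eq_inv_mul, mul_add, Nat.cast_ofNat]

/-- Markov's inequality. -/
theorem mul_prob_le_expect {p : PMF α} {E : Set α} {c : ℝ≥0∞} {f : α → ℝ≥0∞}
    (h : ∀ a ∈ E, c ≤ f a) : c * prob p E ≤ expect p f := by
  rw [prob, PMF.toOuterMeasure_apply, ← ENNReal.tsum_mul_left]
  refine ENNReal.tsum_le_tsum fun a => ?_
  by_cases ha : a ∈ E
  · rw [Set.indicator_of_mem ha, mul_comm]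
    gcongr
    exact h a ha
  · simp [ha]

/-! ### Potentials -/

/-- A family of potentials that do not increase in expectation when the sketch works. In class
`i ≤ I`, a compactor at level `h` with counter `C` and `c` relevant items has the potential
`φ i h C c`, and a single item on its way to level `h` counts as a factor `a i h`. The potential of a
summary is the product over its levels, capped at `K`; all factors are at least `b`. -/
structure IsPotential (S : Schedule) (I : ℕ) (K b : ℝ≥0∞) (a : ℕ → ℕ → ℝ≥0∞)
    (φ : ℕ → ℕ → ℕ → ℕ → ℝ≥0∞) : Prop where
  base_le_one : b ≤ 1
  base_mul : ∀ {z w}, b ≤ z → b ≤ w → b ≤ z * w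
  base_le : ∀ {i}, i ≤ I → ∀ h C c, b ≤ φ i h C c
  min_mul : ∀ {z w}, b ≤ z → b ≤ w → min K (z * w) ≤ min K z * min K w
  zero : ∀ i h, φ i h 0 0 ≤ 1
  add : ∀ {i}, i ≤ I → ∀ h C c r, φ i h C (c + r) ≤ φ i h C c * a i h ^ r
  merge : ∀ {i i₁ i₂}, i₁ ≤ i → i₂ ≤ i → i ≤ I → ∀ h C₁ C₂ c₁ c₂,
    φ i h (C₁ ||| C₂) (c₁ + c₂) ≤ φ i₁ h C₁ c₁ * φ i₂ h C₂ c₂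
  stay : ∀ {i C c}, i ≤ I → C + 1 < 2 ^ Schedule.numSec i → c ≤ S.cut i C + 1 → ∀ h,
    φ i h (C + 1) c ≤ φ i h C c
  compact : ∀ {i C c q z}, i ≤ I → C + 1 < 2 ^ Schedule.numSec i → S.cut i C ≤ q →
    q ≤ S.cut i C + 1 → q < c → b ≤ z → ∀ h,
    min K (z * (φ i h (C + 1) q *
      ((a i (h + 1) ^ ((c - q + 1) / 2) + a i (h + 1) ^ ((c - q) / 2)) / 2))) ≤
      min K (z * φ i h C c)

section

variable {U : Type*} [LinearOrder U]

/-- The product of the potentials of the levels, starting with level `h`; the items at most `y` are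
the relevant ones. -/
noncomputable def pot (y : U) (φ : ℕ → ℕ → ℕ → ℝ≥0∞) : ℕ → List (Compactor U) → ℝ≥0∞
  | _, [] => 1
  | h, l :: ls => φ h l.ctr (l.buf.countP (leB · y)) * pot y φ (h + 1) ls

namespace IsPotential

variable {S : Schedule} {I : ℕ} {K b : ℝ≥0∞} {a : ℕ → ℕ → ℝ≥0∞}
  {φ : ℕ → ℕ → ℕ → ℕ → ℝ≥0∞} (hφ : IsPotential S I K b a φ)
include hφ

theorem le_pot (y : U) {i : ℕ} (hi : i ≤ I) (h : ℕ) (ls : List (Compactor U)) : b ≤ pot y (φ i) h ls := by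
  induction ls generalizing h with
  | nil => exact hφ.base_le_one
  | cons l ls ih => exact hφ.base_mul (hφ.base_le hi _ _ _) (ih _)

theorem anti {i i' : ℕ} (hi : i ≤ i') (hI : i' ≤ I) (h C c : ℕ) : φ i' h C c ≤ φ i h C c := by
  have h1 := hφ.merge hi hi hI h C 0 c 0
  rw [Nat.or_zero, add_zero] at h1
  exact h1.trans (mul_le_of_le_one_right' (hφ.zero i h))

theorem pot_anti (y : U) {i i' : ℕ} (hi : i ≤ i') (hI : i' ≤ I) (h : ℕ)
    (ls : List (Compactor U)) : pot y (φ i') h ls ≤ pot y (φ i) h ls := by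
  induction ls generalizing h with
  | nil => exact le_rfl
  | cons l ls ih => exact mul_le_mul' (hφ.anti hi hI _ _ _) (ih _)

theorem pot_zipLevels (y : U) {i i₁ i₂ : ℕ} (h₁ : i₁ ≤ i) (h₂ : i₂ ≤ i) (hI : i ≤ I) (h : ℕ)
    (ls ls' : List (Compactor U)) :
    pot y (φ i) h (zipLevels ls ls') ≤ pot y (φ i₁) h ls * pot y (φ i₂) h ls' := by
  induction ls generalizing ls' h with
  | nil => simpa [zipLevels, pot] using hφ.pot_anti y h₂ hI h ls'
  | cons l ls ih =>
    cases ls' with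
    | nil => simpa [zipLevels, pot] using hφ.pot_anti y h₁ hI h (l :: ls)
    | cons l' ls' =>
      simp only [zipLevels, pot, List.countP_append]
      rw [mul_mul_mul_comm]
      exact mul_le_mul' (hφ.merge h₁ h₂ hI _ _ _ _ _) (ih _ _)

/-- The expected potential does not increase in one compaction. -/
theorem expect_compactLevel (y : U) {i : ℕ} (hI : i ≤ I) (h : ℕ) {l : Compactor U}
    (hl : l.ctr + 1 < 2 ^ Schedule.numSec i) {z : ℝ≥0∞} (hz : b ≤ z) :
    expect coin (fun d => min K (z * (φ i h (compactLevel S leB i d l).1.ctr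
      ((compactLevel S leB i d l).1.buf.countP (leB · y)) *
      a i (h + 1) ^ (compactLevel S leB i d l).2.countP (leB · y)))) ≤
    min K (z * φ i h l.ctr (l.buf.countP (leB · y))) := by
  rcases le_or_gt l.buf.length (S.cap i) with hc | hc
  · simp only [compactLevel_of_le S leB i _ l hc, List.countP_nil, pow_zero, mul_one]
    rw [expect_const]
  · obtain ⟨q, h1, h2, h3⟩ := compactLevel_countP S i l y hc
    simp only [h3]
    rcases le_or_gt (l.buf.countP (leB · y)) q with hq | hq
    · have : ∀ d : Bool, (l.buf.countP (leB · y) - q + if d then 1 else 0) / 2 = 0 := by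
        intro d
        cases d <;> simp [Nat.sub_eq_zero_of_le hq]
      simp only [this, pow_zero, mul_one, min_eq_left hq, expect_const]
      gcongr
      exact hφ.stay hI hl (hq.trans h2) h
    · refine le_trans ?_ (hφ.compact hI hl h1 h2 hq hz h)
      simp only [min_eq_right hq.le, expect_coin, if_true, Bool.false_eq_true, if_false, add_zero]
      refine le_min ?_ ?_
      · calc (min K _ + min K _) / 2 ≤ (K + K) / 2 := by gcongr <;> exact min_le_left _ _
          _ = K := by rw [ENNReal.add_div, ENNReal.add_halves]
      · refine (ENNReal.div_le_div_right (add_le_add (min_le_right _ _) (min_le_right _ _))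
          _).trans_eq ?_
        simp only [div_eq_mul_inv]
        ring

theorem pot_topLevel (y : U) {i : ℕ} (hI : i ≤ I) (h : ℕ) (c : List U) :
    pot y (φ i) h (topLevel c) ≤ a i h ^ c.countP (leB · y) := by
  cases c with
  | nil => simp [topLevel, pot]
  | cons x c =>
    have h1 := hφ.add hI h 0 0 ((x :: c).countP (leB · y))
    rw [zero_add] at h1
    simpa [topLevel, pot] using h1.trans (mul_le_of_le_one_left' (hφ.zero i h))

/-- The expected potential does not increase when the sketch compacts all its levels. -/
theorem expect_compactFrom (y : U) {i : ℕ} (hI : i ≤ I) (h : ℕ) (c : List U)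
    (ls : List (Compactor U)) (hls : ∀ l ∈ ls, l.ctr + 1 < 2 ^ Schedule.numSec i) {z : ℝ≥0∞}
    (hz : b ≤ z) :
    expect (compactFrom S leB i c ls) (fun r => min K (z * pot y (φ i) h r)) ≤
      min K (z * (a i h ^ c.countP (leB · y) * pot y (φ i) h ls)) := by
  induction ls generalizing c h z with
  | nil =>
    rw [compactFrom]
    split_ifs with hc
    · rw [List.isEmpty_iff] at hc
      simp [hc, expect_pure, pot]
    · rw [expect_map]
      have h0 : 0 + 1 < 2 ^ Schedule.numSec i :=
        Nat.one_lt_two_pow (by unfold Schedule.numSec; positivity)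
      refine le_trans (expect_mono fun d _ => ?_)
        ((hφ.expect_compactLevel y hI h (l := ⟨0, c⟩) h0 hz).trans ?_)
      · simp only [pot]
        gcongr
        exact hφ.pot_topLevel y hI _ _
      · have h1 := hφ.add hI h 0 0 (c.countP (leB · y))
        rw [zero_add] at h1
        rw [pot, mul_one]
        gcongr
        exact h1.trans (mul_le_of_le_one_left' (hφ.zero i h))
  | cons l ls ih =>
    rw [List.forall_mem_cons] at hls
    rw [compactFrom, expect_bind]
    simp only [expect_map, pot]
    have hz' : b ≤ z * pot y (φ i) (h + 1) ls := hφ.base_mul hz (hφ.le_pot y hI _ _)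
    refine le_trans (expect_mono fun d _ => ?_)
      ((hφ.expect_compactLevel y hI h (l := ⟨l.ctr, l.buf ++ c⟩) hls.1 hz').trans ?_)
    · have h2 := ih (h + 1) (compactLevel S leB i d ⟨l.ctr, l.buf ++ c⟩).2 hls.2
        (hφ.base_mul hz (hφ.base_le hI h (compactLevel S leB i d ⟨l.ctr, l.buf ++ c⟩).1.ctr
          ((compactLevel S leB i d ⟨l.ctr, l.buf ++ c⟩).1.buf.countP (leB · y))))
      simp only [mul_assoc] at h2 ⊢
      refine h2.trans_eq ?_
      congr 2
      ring
    · simp only [List.countP_append]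
      gcongr min K ?_
      calc _ ≤ z * pot y (φ i) (h + 1) ls * _ :=
            mul_le_mul_right (hφ.add hI h l.ctr _ (c.countP (leB · y))) _
        _ = _ := by ring

/-- The expected potential does not increase when two summaries are merged. -/
theorem expect_mergeStates (y : U) (hS : S.Regular) {i₁ i₂ n m : ℕ} {s t : State U}
    (hs : Invariant S n s) (ht : Invariant S m t) (h₁ : i₁ ≤ S.cls (n + m))
    (h₂ : i₂ ≤ S.cls (n + m)) (hI : S.cls (n + m) ≤ I) :
    expect (mergeStates S leB s t) (fun r => min K (pot y (φ (S.cls r.count)) 0 r.levels)) ≤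
      min K (pot y (φ i₁) 0 s.levels) * min K (pot y (φ i₂) 0 t.levels) := by
  rw [mergeStates, expect_map, hs.count_eq, ht.count_eq]
  have h := hφ.expect_compactFrom y hI 0 [] _ (hS.ctr_lt_zipLevels hs ht) hφ.base_le_one
  simp only [one_mul, List.countP_nil, pow_zero] at h
  exact (h.trans (min_le_min_left _ (hφ.pot_zipLevels y h₁ h₂ hI 0 _ _))).trans
    (hφ.min_mul (hφ.le_pot y (h₁.trans hI) _ _) (hφ.le_pot y (h₂.trans hI) _ _))

/-- The expected potential of a summary is bounded by one factor for each relevant input item. -/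
theorem expect_runState_le (y : U) (hS : S.Regular) (t : History U) (hI : S.cls t.card ≤ I) :
    expect (runState S t) (fun s => min K (pot y (φ (S.cls s.count)) 0 s.levels)) ≤
      a 0 0 ^ t.rank y := by
  induction t with
  | empty =>
    rw [runState, expect_pure]
    simp [pot, History.rank, History.input]
  | insert t x ih =>
    rw [card_insert] at hI
    have hle : S.cls t.card ≤ S.cls (t.card + 1) := hS.cls_mono (by omega)
    rw [runState, expect_bind, rank_insert, pow_add]
    refine le_trans (expect_mono fun s hs => ?_)
      (((expect_mul_left _ (a 0 0 ^ if x ≤ y then 1 else 0) _).le.trans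
        (mul_le_mul_right (ih (hle.trans hI)) _)).trans_eq (mul_comm _ _))
    have hinv := invariant_runState hS t hs
    refine (hφ.expect_mergeStates y hS hinv (invariant_single S x) hle (Nat.zero_le _) hI).trans ?_
    rw [mul_comm, hinv.count_eq]
    gcongr
    refine (min_le_right _ _).trans ?_
    have h1 := hφ.pot_topLevel y (Nat.zero_le I) 0 [x]
    simpa [topLevel, single, List.countP_cons, leB] using h1
  | merge t₁ t₂ ih₁ ih₂ =>
    rw [card_merge] at hI
    have hle₁ : S.cls t₁.card ≤ S.cls (t₁.card + t₂.card) := hS.cls_mono (by omega)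
    have hle₂ : S.cls t₂.card ≤ S.cls (t₁.card + t₂.card) := hS.cls_mono (by omega)
    rw [runState, expect_bind, rank_merge, pow_add]
    refine le_trans (expect_mono fun s₁ hs₁ => ?_)
      (((expect_mul_left _ (a 0 0 ^ t₂.rank y) _).le.trans
        (mul_le_mul_right (ih₁ (hle₁.trans hI)) _)).trans_eq (mul_comm _ _))
    rw [expect_bind, mul_comm]
    refine le_trans (expect_mono fun s₂ hs₂ => ?_)
      ((expect_mul_left _ _ _).le.trans (mul_le_mul_right (ih₂ (hle₂.trans hI)) _))
    have hinv₁ := invariant_runState hS t₁ hs₁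
    have hinv₂ := invariant_runState hS t₂ hs₂
    rw [hinv₁.count_eq, hinv₂.count_eq]
    exact hφ.expect_mergeStates y hS hinv₁ hinv₂ hle₁ hle₂ hI

end IsPotential

end

/-! ### The exponents of the potentials -/

/-- The moment generating function of the number of promoted items, when every other one of `r`
items is promoted. -/
theorem half_exp_add_exp_le (A : ℝ) (r : ℕ) :
    (Real.exp (A * ((r + 1) / 2 : ℕ)) + Real.exp (A * (r / 2 : ℕ))) / 2 ≤
      Real.exp (A * r / 2 + A ^ 2 / 8) := by
  rcases Nat.even_or_odd' r with ⟨k, rfl | rfl⟩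
  · rw [show (2 * k + 1) / 2 = k by omega, show 2 * k / 2 = k by omega, add_self_div_two]
    refine Real.exp_le_exp.2 ?_
    push_cast
    nlinarith [sq_nonneg A]
  · rw [show (2 * k + 1 + 1) / 2 = k + 1 by omega, show (2 * k + 1) / 2 = k by omega]
    have h1 := Real.cosh_le_exp_half_sq (A / 2)
    rw [Real.cosh_eq] at h1
    have h2 : Real.exp (A * (k + 1 : ℕ)) = Real.exp (A * k + A / 2) * Real.exp (A / 2) := by
      rw [← Real.exp_add]; congr 1; push_cast; ring
    have h3 : Real.exp (A * k) = Real.exp (A * k + A / 2) * Real.exp (-(A / 2)) := by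
      rw [← Real.exp_add]; congr 1; ring
    have h4 : A * ((2 * k + 1 : ℕ) : ℝ) / 2 + A ^ 2 / 8 = A * k + A / 2 + (A / 2) ^ 2 / 2 := by
      push_cast; ring
    rw [h2, h3, ← mul_add, mul_div_assoc, h4, Real.exp_add (A * k + A / 2)]
    gcongr

namespace Schedule

variable (S : Schedule) (I : ℕ) (lam R : ℝ)

/-- The share of class `j` in the surplus of an item at level `h`, relative to its weight. The
increment from level `h + 1` to level `h` pays for the compactions of class `j` at level `h`, as long
as `2 ^ h * prot < 2 * R`: at higher levels, no such compaction affects relevant items. -/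
noncomputable def share (j h : ℕ) : ℝ :=
  2 * lam / S.width j * max 0 (4 * R / S.prot j - 2 ^ h)

/-- The surplus of an item at level `h` in a summary of class `i`: it covers the cost of all the
compactions in the classes from `i` to `I` at the levels from `h` upwards. -/
noncomputable def surplus (i h : ℕ) : ℝ :=
  lam * 2 ^ h * ∑ j ∈ Finset.Ico i (I + 1), S.share lam R j h

/-- What one unit of debt costs: `width` units cover the variance of one compaction. -/
noncomputable def unitCost (i h : ℕ) : ℝ :=
  if 2 ^ h * (S.prot i : ℝ) < 2 * R then 2 * lam ^ 2 * 4 ^ h / S.width i else 0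

/-- The exponent of the potential of a compactor with counter `C` and `c` relevant items. The sign
`σ` is `1` for the upper tail and `-1` for the lower tail. -/
noncomputable def exponent (σ : ℝ) (i h C c : ℕ) : ℝ :=
  (σ * lam * 2 ^ h + S.surplus I lam R i h) * c - S.unitCost lam R i h * S.debt i C c

/-- The sum of the surpluses, relative to `lam`, of a relevant input item. -/
noncomputable def totalShare : ℝ :=
  ∑ j ∈ Finset.range (I + 1), 8 * lam * R / (S.width j * S.prot j)

variable {S I lam R} (hS : S.Regular) (hlam : 0 ≤ lam) (hR : 0 ≤ R)

theorem prot_pos (i : ℕ) : (0 : ℝ) < S.prot i := by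
  unfold prot numSec sec
  positivity

include hlam in
theorem share_nonneg (j h : ℕ) : 0 ≤ S.share lam R j h := by
  unfold share
  positivity

theorem unitCost_nonneg (i h : ℕ) : 0 ≤ S.unitCost lam R i h := by
  unfold unitCost
  split_ifs <;> positivity

include hlam in
theorem share_anti (j h : ℕ) : S.share lam R j (h + 1) ≤ S.share lam R j h := by
  unfold share
  have : (2 : ℝ) ^ h ≤ 2 ^ (h + 1) := pow_le_pow_right₀ (by norm_num) (by omega)
  gcongr

include hlam in
theorem unitCost_le_sub (i h : ℕ) :
    S.unitCost lam R i h ≤ lam * 2 ^ h * (S.share lam R i h - S.share lam R i (h + 1)) := by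
  unfold unitCost
  split_ifs with h1
  · have h2 : (2 : ℝ) ^ h < 2 * R / S.prot i := by rwa [lt_div_iff₀ (prot_pos i)]
    have h3 : 4 * R / S.prot i = 2 * (2 * R / S.prot i) := by ring
    have h4 : S.share lam R i h - S.share lam R i (h + 1) = 2 * lam / S.width i * 2 ^ h := by
      unfold share
      rw [max_eq_right, max_eq_right, pow_succ]
      · ring
      · rw [h3, pow_succ]; linarith
      · rw [h3]; have : (0 : ℝ) < 2 ^ h := by positivity
        linarith
    have h5 : (4 : ℝ) ^ h = 2 ^ h * 2 ^ h := by rw [← mul_pow]; norm_num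
    rw [h4, h5]
    apply le_of_eq
    ring
  · exact mul_nonneg (by positivity) (sub_nonneg.2 (share_anti hlam i h))

include hlam in
theorem unitCost_le_share (i h : ℕ) :
    S.unitCost lam R i h ≤ lam * 2 ^ h * S.share lam R i h := by
  refine (unitCost_le_sub hlam i h).trans ?_
  have := share_nonneg (S := S) (R := R) hlam i (h + 1)
  gcongr
  linarith

include hlam in
theorem surplus_nonneg (i h : ℕ) : 0 ≤ S.surplus I lam R i h :=
  mul_nonneg (by positivity) (Finset.sum_nonneg fun j _ => share_nonneg hlam j h)

include hlam in
theorem unitCost_le_surplus_sub_half {i : ℕ} (hi : i ≤ I) (h : ℕ) :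
    S.unitCost lam R i h ≤ S.surplus I lam R i h - S.surplus I lam R i (h + 1) / 2 := by
  have h1 : S.surplus I lam R i h - S.surplus I lam R i (h + 1) / 2 = lam * 2 ^ h *
      ∑ j ∈ Finset.Ico i (I + 1), (S.share lam R j h - S.share lam R j (h + 1)) := by
    unfold surplus
    rw [Finset.sum_sub_distrib, pow_succ]
    ring
  rw [h1]
  refine (unitCost_le_sub hlam i h).trans (mul_le_mul_of_nonneg_left ?_ (by positivity))
  exact Finset.single_le_sum (f := fun j => S.share lam R j h - S.share lam R j (h + 1))
    (fun j _ => sub_nonneg.2 (share_anti hlam j h)) (Finset.mem_Ico.2 ⟨le_rfl, by omega⟩)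

include hlam in
theorem unitCost_le_surplus {i : ℕ} (hi : i ≤ I) (h : ℕ) :
    S.unitCost lam R i h ≤ S.surplus I lam R i h := by
  have := unitCost_le_surplus_sub_half (S := S) (R := R) hlam hi h
  have := surplus_nonneg (S := S) (R := R) (I := I) hlam i (h + 1)
  linarith

include hlam in
theorem unitCost_le_surplus_sub {i i' : ℕ} (hi : i < i') (hI : i' ≤ I) (h : ℕ) :
    S.unitCost lam R i h ≤ S.surplus I lam R i h - S.surplus I lam R i' h := by
  have h1 : S.surplus I lam R i h - S.surplus I lam R i' h =
      lam * 2 ^ h * ∑ j ∈ Finset.Ico i i', S.share lam R j h := by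
    unfold surplus
    rw [← Finset.sum_Ico_consecutive _ hi.le (show i' ≤ I + 1 by omega)]
    ring
  rw [h1]
  refine (unitCost_le_share hlam i h).trans (mul_le_mul_of_nonneg_left ?_ (by positivity))
  exact Finset.single_le_sum (f := fun j => S.share lam R j h)
    (fun j _ => share_nonneg hlam j h) (Finset.mem_Ico.2 ⟨le_rfl, hi⟩)

include hlam hR in
theorem surplus_le (i h : ℕ) :
    S.surplus I lam R i h ≤ lam * 2 ^ h * S.totalShare I lam R := by
  refine mul_le_mul_of_nonneg_left ?_ (by positivity)
  have h1 : ∀ j, S.share lam R j h ≤ 8 * lam * R / (S.width j * S.prot j) := by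
    intro j
    have h2 : max 0 (4 * R / S.prot j - 2 ^ h) ≤ 4 * R / (S.prot j : ℝ) :=
      max_le (by positivity) (by linarith [show (0 : ℝ) < 2 ^ h by positivity])
    calc S.share lam R j h ≤ 2 * lam / S.width j * (4 * R / S.prot j) := by
          unfold share
          gcongr
      _ = _ := by rw [div_mul_div_comm]; ring
  refine (Finset.sum_le_sum fun j _ => h1 j).trans
    (Finset.sum_le_sum_of_subset_of_nonneg ?_ fun j _ _ => by positivity)
  intro j
  simp

theorem exponent_zero (σ : ℝ) (i h : ℕ) : S.exponent I lam R σ i h 0 0 = 0 := by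
  have : S.debt i 0 0 = 0 := Nat.le_zero.1 (S.debt_le i 0 0)
  simp [exponent, this]

theorem exponent_add (σ : ℝ) (i h C c r : ℕ) :
    S.exponent I lam R σ i h C (c + r) ≤ S.exponent I lam R σ i h C c +
      r * (σ * lam * 2 ^ h + S.surplus I lam R i h) := by
  have h1 : (S.debt i C c : ℝ) ≤ S.debt i C (c + r) := by
    exact_mod_cast S.debt_mono i (fun _ => id) (by omega)
  have := mul_le_mul_of_nonneg_left h1 (unitCost_nonneg (S := S) (lam := lam) (R := R) i h)
  unfold exponent
  push_cast
  linarith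

include hlam in
theorem le_exponent {i : ℕ} (hi : i ≤ I) (σ : ℝ) (h C c : ℕ) :
    σ * lam * 2 ^ h * c ≤ S.exponent I lam R σ i h C c := by
  have h1 : (S.debt i C c : ℝ) ≤ c := by exact_mod_cast S.debt_le i C c
  have h2 := mul_le_mul_of_nonneg_left h1 (unitCost_nonneg (S := S) (lam := lam) (R := R) i h)
  have h3 := mul_le_mul_of_nonneg_right
    (unitCost_le_surplus (S := S) (R := R) hlam hi h) (Nat.cast_nonneg c)
  unfold exponent
  linarith

include hlam in
theorem exponent_anti {i i' : ℕ} (hi : i ≤ i') (hI : i' ≤ I) (σ : ℝ) (h C c : ℕ) :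
    S.exponent I lam R σ i' h C c ≤ S.exponent I lam R σ i h C c := by
  rcases hi.eq_or_lt with rfl | hi
  · exact le_rfl
  -- the surplus that is released when the class changes settles the debt of the old class
  have h1 : (S.debt i C c : ℝ) ≤ c := by exact_mod_cast S.debt_le i C c
  have h2 := mul_le_mul_of_nonneg_left h1 (unitCost_nonneg (S := S) (lam := lam) (R := R) i h)
  have h3 := mul_le_mul_of_nonneg_right
    (unitCost_le_surplus_sub (S := S) (R := R) hlam hi hI h) (Nat.cast_nonneg c)
  have h4 := mul_nonneg (unitCost_nonneg (S := S) (lam := lam) (R := R) i' h)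
    (Nat.cast_nonneg (S.debt i' C c))
  unfold exponent
  linarith

include hlam in
theorem exponent_merge {i i₁ i₂ : ℕ} (h₁ : i₁ ≤ i) (h₂ : i₂ ≤ i) (hI : i ≤ I) (σ : ℝ)
    (h C₁ C₂ c₁ c₂ : ℕ) :
    S.exponent I lam R σ i h (C₁ ||| C₂) (c₁ + c₂) ≤
      S.exponent I lam R σ i₁ h C₁ c₁ + S.exponent I lam R σ i₂ h C₂ c₂ := by
  refine le_trans ?_ (add_le_add (exponent_anti hlam h₁ hI σ h C₁ c₁)
    (exponent_anti hlam h₂ hI σ h C₂ c₂))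
  have h1 : (S.debt i C₁ c₁ + S.debt i C₂ c₂ : ℝ) ≤ S.debt i (C₁ ||| C₂) (c₁ + c₂) := by
    exact_mod_cast S.debt_merge i C₁ C₂ c₁ c₂
  have h2 := mul_le_mul_of_nonneg_left h1 (unitCost_nonneg (S := S) (lam := lam) (R := R) i h)
  unfold exponent
  push_cast
  linarith

include hS in
theorem exponent_stay {i C c : ℕ} (hC : C + 1 < 2 ^ numSec i) (hc : c ≤ S.cut i C + 1) (σ : ℝ)
    (h : ℕ) : S.exponent I lam R σ i h (C + 1) c ≤ S.exponent I lam R σ i h C c := by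
  have h1 : (S.debt i C c : ℝ) ≤ S.debt i (C + 1) c := by
    exact_mod_cast S.debt_compact_of_le i (hS.width_pos i) hC hc
  have h2 := mul_le_mul_of_nonneg_left h1 (unitCost_nonneg (S := S) (lam := lam) (R := R) i h)
  unfold exponent
  linarith

include hS hlam hR in
/-- A compaction that affects relevant items is paid for, provided that its level is low enough. -/
theorem exponent_compact {i C c q : ℕ} (hI : i ≤ I) (hC : C + 1 < 2 ^ numSec i)
    (hq : S.cut i C ≤ q) (hq' : q ≤ S.cut i C + 1) (hc : q < c) {σ : ℝ} (hσ : |σ| ≤ 1) {h : ℕ}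
    (hsum : S.totalShare I lam R ≤ 1) (hP : 2 ^ h * (S.prot i : ℝ) < 2 * R) :
    Real.exp (S.exponent I lam R σ i h (C + 1) q) *
      ((Real.exp ((σ * lam * 2 ^ (h + 1) + S.surplus I lam R i (h + 1)) *
          ((c - q + 1) / 2 : ℕ)) +
        Real.exp ((σ * lam * 2 ^ (h + 1) + S.surplus I lam R i (h + 1)) *
          ((c - q) / 2 : ℕ))) / 2) ≤
      Real.exp (S.exponent I lam R σ i h C c) := by
  set A := σ * lam * 2 ^ (h + 1) + S.surplus I lam R i (h + 1) with hA
  refine (mul_le_mul_of_nonneg_left (half_exp_add_exp_le A (c - q)) (Real.exp_nonneg _)).trans ?_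
  rw [← Real.exp_add, Real.exp_le_exp]
  have hx : 0 ≤ lam * 2 ^ (h + 1) := by positivity
  have hAle : A ^ 2 / 8 ≤ 2 * lam ^ 2 * 4 ^ h := by
    have h1 := surplus_le (S := S) (I := I) hlam hR i (h + 1)
    have h2 := surplus_nonneg (S := S) (R := R) (I := I) hlam i (h + 1)
    have h3 := mul_le_mul_of_nonneg_left hsum hx
    have h4 := abs_le.1 hσ
    have h5 : |A| ≤ 2 * (lam * 2 ^ (h + 1)) := by
      rw [abs_le, hA, mul_assoc]
      constructor <;> nlinarith
    have h6 : A ^ 2 ≤ (2 * (lam * 2 ^ (h + 1))) ^ 2 := sq_le_sq' (abs_le.1 h5).1 (abs_le.1 h5).2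
    have h7 : (2 * (lam * 2 ^ (h + 1))) ^ 2 = 16 * lam ^ 2 * 4 ^ h := by
      rw [show (4 : ℝ) = 2 ^ 2 by norm_num, ← pow_mul, mul_comm 2 h, pow_mul, pow_succ]
      ring
    linarith
  have hcost : S.unitCost lam R i h * S.width i = 2 * lam ^ 2 * 4 ^ h := by
    have : (S.width i : ℝ) ≠ 0 := by exact_mod_cast (hS.width_pos i).ne'
    rw [unitCost, if_pos hP]
    field_simp
  have hdebt : (S.debt i C c : ℝ) + S.width i ≤ (c - q) + S.debt i (C + 1) q := by
    rw [← Nat.cast_sub hc.le]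
    exact_mod_cast S.debt_compact_of_lt i hC hq hq' hc
  have h1 := mul_le_mul_of_nonneg_left hdebt (unitCost_nonneg (S := S) (lam := lam) (R := R) i h)
  have h2 : (q : ℝ) ≤ c := by exact_mod_cast hc.le
  have h3 := mul_le_mul_of_nonneg_right
    (unitCost_le_surplus_sub_half (S := S) (R := R) hlam hI h) (sub_nonneg.2 h2)
  unfold exponent
  rw [Nat.cast_sub hc.le]
  have h4 : A * (c - q : ℝ) / 2 = (σ * lam * 2 ^ h + S.surplus I lam R i (h + 1) / 2) * (c - q) := by
    rw [hA, pow_succ]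
    ring
  rw [h4]
  linarith

/-! ### The two potentials -/

variable (S I lam R)

/-- The factor by which an item on its way to level `h` counts. -/
noncomputable def itemFactor (σ : ℝ) (i h : ℕ) : ℝ≥0∞ :=
  ENNReal.ofReal (Real.exp (σ * lam * 2 ^ h + S.surplus I lam R i h))

/-- The potential for the upper tail. -/
noncomputable def upper (i h C c : ℕ) : ℝ≥0∞ :=
  ENNReal.ofReal (Real.exp (S.exponent I lam R 1 i h C c))

/-- A compactor is overfull if its relevant items alone account for a twofold overestimate of the
rank and no compaction will change this. -/
def Overfull (i h c : ℕ) : Prop := 2 * R ≤ 2 ^ h * (c : ℝ) ∧ 2 * R ≤ 2 ^ h * (S.prot i : ℝ)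

open Classical in
/-- The potential for the lower tail; it vanishes for overfull compactors. -/
noncomputable def lower (i h C c : ℕ) : ℝ≥0∞ :=
  if S.Overfull R i h c then 0 else ENNReal.ofReal (Real.exp (S.exponent I lam R (-1) i h C c))

variable {S I lam R}

theorem itemFactor_pow (σ : ℝ) (i h r : ℕ) : S.itemFactor I lam R σ i h ^ r =
    ENNReal.ofReal (Real.exp ((σ * lam * 2 ^ h + S.surplus I lam R i h) * r)) := by
  rw [itemFactor, ← ENNReal.ofReal_pow (Real.exp_nonneg _), ← Real.exp_nat_mul, mul_comm]

theorem ofReal_half_add {x y : ℝ} (hx : 0 ≤ x) (hy : 0 ≤ y) :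
    (ENNReal.ofReal x + ENNReal.ofReal y) / 2 = ENNReal.ofReal ((x + y) / 2) := by
  rw [← ENNReal.ofReal_add hx hy, ENNReal.ofReal_div_of_pos (by norm_num), ENNReal.ofReal_ofNat]

include hS hlam hR in
theorem ofReal_exponent_compact {i C c q : ℕ} (hI : i ≤ I) (hC : C + 1 < 2 ^ numSec i)
    (hq : S.cut i C ≤ q) (hq' : q ≤ S.cut i C + 1) (hc : q < c) {σ : ℝ} (hσ : |σ| ≤ 1) {h : ℕ}
    (hsum : S.totalShare I lam R ≤ 1) (hP : 2 ^ h * (S.prot i : ℝ) < 2 * R) :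
    ENNReal.ofReal (Real.exp (S.exponent I lam R σ i h (C + 1) q)) *
      ((S.itemFactor I lam R σ i (h + 1) ^ ((c - q + 1) / 2) +
        S.itemFactor I lam R σ i (h + 1) ^ ((c - q) / 2)) / 2) ≤
      ENNReal.ofReal (Real.exp (S.exponent I lam R σ i h C c)) := by
  rw [itemFactor_pow, itemFactor_pow, ofReal_half_add (Real.exp_nonneg _) (Real.exp_nonneg _),
    ← ENNReal.ofReal_mul (Real.exp_nonneg _)]
  exact ENNReal.ofReal_le_ofReal (exponent_compact hS hlam hR hI hC hq hq' hc hσ hsum hP)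

theorem one_le_ofReal_exp {x : ℝ} (hx : 0 ≤ x) : 1 ≤ ENNReal.ofReal (Real.exp x) := by
  rw [← ENNReal.ofReal_one]
  exact ENNReal.ofReal_le_ofReal (Real.one_le_exp hx)

theorem ofReal_exp_add (x y : ℝ) : ENNReal.ofReal (Real.exp (x + y)) =
    ENNReal.ofReal (Real.exp x) * ENNReal.ofReal (Real.exp y) := by
  rw [Real.exp_add, ENNReal.ofReal_mul (Real.exp_nonneg _)]

theorem ofReal_exp_mono {x y : ℝ} (h : x ≤ y) :
    ENNReal.ofReal (Real.exp x) ≤ ENNReal.ofReal (Real.exp y) :=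
  ENNReal.ofReal_le_ofReal (Real.exp_le_exp.2 h)

theorem min_mul_le {K z w : ℝ≥0∞} (hK : 1 ≤ K) (hz : 1 ≤ z) (hw : 1 ≤ w) :
    min K (z * w) ≤ min K z * min K w := by
  rcases le_total K z with h | h <;> rcases le_total K w with h' | h'
  · rw [min_eq_left h, min_eq_left h']
    exact (min_le_left _ _).trans (le_mul_of_one_le_left' hK)
  · rw [min_eq_left h, min_eq_right h']
    exact (min_le_left _ _).trans (le_mul_of_one_le_right' hw)
  · rw [min_eq_right h, min_eq_left h']
    exact (min_le_left _ _).trans (le_mul_of_one_le_left' hz)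
  · rw [min_eq_right h, min_eq_right h']
    exact min_le_right _ _

include hS hlam hR in
theorem isPotential_upper (hsum : S.totalShare I lam R ≤ 1) :
    IsPotential S I (ENNReal.ofReal (Real.exp (2 * lam * R))) 1 (S.itemFactor I lam R 1)
      (S.upper I lam R) where
  base_le_one := le_rfl
  base_mul := fun hz hw => one_le_mul hz hw
  base_le := by
    intro i hi h C c
    refine one_le_ofReal_exp (le_trans ?_ (le_exponent hlam hi 1 h C c))
    positivity
  min_mul := fun hz hw => min_mul_le (one_le_ofReal_exp (by positivity)) hz hw
  zero := by
    intro i h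
    simp [upper, exponent_zero]
  add := by
    intro i hi h C c r
    rw [itemFactor_pow, upper, upper, ← ofReal_exp_add]
    refine ofReal_exp_mono ((exponent_add 1 i h C c r).trans_eq ?_)
    ring
  merge := by
    intro i i₁ i₂ h₁ h₂ hI h C₁ C₂ c₁ c₂
    rw [upper, upper, upper, ← ofReal_exp_add]
    exact ofReal_exp_mono (exponent_merge hlam h₁ h₂ hI 1 h C₁ C₂ c₁ c₂)
  stay := by
    intro i C c hI hC hc h
    exact ofReal_exp_mono (exponent_stay hS hC hc 1 h)
  compact := by
    intro i C c q z hI hC hq hq' hc hz h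
    rcases lt_or_ge (2 ^ h * (c : ℝ)) (2 * R) with hlt | hge
    · gcongr
      refine ofReal_exponent_compact hS hlam hR hI hC hq hq' hc (by simp) hsum (lt_of_le_of_lt ?_ hlt)
      have := S.prot_le_cut i C
      have h1 : (S.prot i : ℝ) ≤ c := by exact_mod_cast (by omega : S.prot i ≤ c)
      gcongr
    · -- the potential has reached the cap
      refine (min_le_left _ _).trans (le_min le_rfl ?_)
      refine le_trans ?_ (le_mul_of_one_le_left' hz)
      refine ofReal_exp_mono (le_trans ?_ (le_exponent hlam hI 1 h C c))
      nlinarith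

include hS hlam hR in
theorem isPotential_lower (hsum : S.totalShare I lam R ≤ 1) :
    IsPotential S I ⊤ 0 (S.itemFactor I lam R (-1)) (S.lower I lam R) where
  base_le_one := zero_le_one
  base_mul := fun _ _ => zero_le
  base_le := fun _ _ _ _ => zero_le
  min_mul := by simp
  zero := by
    intro i h
    unfold lower
    split_ifs
    · exact zero_le_one
    · simp [exponent_zero]
  add := by
    intro i hi h C c r
    unfold lower
    split_ifs with h1 h2 h2
    · exact zero_le
    · exact zero_le
    · refine absurd ⟨h2.1.trans ?_, h2.2⟩ h1
      gcongr
      omega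
    · rw [itemFactor_pow, ← ofReal_exp_add]
      refine ofReal_exp_mono ((exponent_add (-1) i h C c r).trans_eq ?_)
      ring
  merge := by
    intro i i₁ i₂ h₁ h₂ hI h C₁ C₂ c₁ c₂
    have key : ∀ {j c : ℕ}, j ≤ i → c ≤ c₁ + c₂ → S.Overfull R j h c →
        S.Overfull R i h (c₁ + c₂) := by
      intro j c hj hc ho
      have h1 : (S.prot j : ℝ) ≤ S.prot i := by exact_mod_cast hS.prot_mono hj
      have h2 : (c : ℝ) ≤ (c₁ + c₂ : ℕ) := by exact_mod_cast hc
      exact ⟨ho.1.trans (by gcongr), ho.2.trans (by gcongr)⟩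
    by_cases g : S.Overfull R i h (c₁ + c₂)
    · rw [lower, if_pos g]
      exact zero_le
    · rw [lower, lower, lower, if_neg g, if_neg fun g₁ => g (key h₁ (by omega) g₁),
        if_neg fun g₂ => g (key h₂ (by omega) g₂), ← ofReal_exp_add]
      exact ofReal_exp_mono (exponent_merge hlam h₁ h₂ hI (-1) h C₁ C₂ c₁ c₂)
  stay := by
    intro i C c hI hC hc h
    unfold lower
    split_ifs with g
    · exact le_rfl
    · exact ofReal_exp_mono (exponent_stay hS hC hc (-1) h)
  compact := by
    intro i C c q z hI hC hq hq' hc hz h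
    rw [min_eq_right le_top, min_eq_right le_top]
    gcongr
    have hPq : (S.prot i : ℝ) ≤ q := by exact_mod_cast (S.prot_le_cut i C).trans hq
    have hqc : (q : ℝ) ≤ c := by exact_mod_cast hc.le
    rcases lt_or_ge (2 ^ h * (S.prot i : ℝ)) (2 * R) with hlt | hge
    · have h1 : ∀ c', ¬ S.Overfull R i h c' := fun c' hc' => hc'.2.not_gt hlt
      rw [lower, lower, if_neg (h1 _), if_neg (h1 _)]
      exact ofReal_exponent_compact hS hlam hR hI hC hq hq' hc (by simp) hsum hlt
    · have h1 : S.Overfull R i h q := ⟨hge.trans (by gcongr), hge⟩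
      rw [lower, if_pos h1, zero_mul]
      exact zero_le

end Schedule

/-! ### The error probability -/

section

variable {U : Type*} [LinearOrder U] {S : Schedule} {I : ℕ} {lam R : ℝ}

theorem ofReal_exp_le_pot_upper (hlam : 0 ≤ lam) {i : ℕ} (hi : i ≤ I) (y : U) (h : ℕ)
    (ls : List (Compactor U)) :
    ENNReal.ofReal (Real.exp (lam * 2 ^ h * weightedCount (leB · y) ls)) ≤
      pot y (S.upper I lam R i) h ls := by
  induction ls generalizing h with
  | nil => simp [weightedCount, pot]
  | cons l ls ih =>
    have h1 := S.le_exponent (R := R) hlam hi 1 h l.ctr (l.buf.countP (leB · y))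
    rw [one_mul] at h1
    refine le_trans (le_of_eq ?_) (mul_le_mul' (Schedule.ofReal_exp_mono h1) (ih (h + 1)))
    rw [← Schedule.ofReal_exp_add, weightedCount]
    push_cast
    congr 2
    ring

/-- As long as the rank is not overestimated by a factor of two, no compactor is overfull. -/
theorem ofReal_exp_le_pot_lower (hlam : 0 ≤ lam) {i : ℕ} (hi : i ≤ I) (y : U) (h : ℕ)
    (ls : List (Compactor U)) (hls : 2 ^ h * (weightedCount (leB · y) ls : ℝ) < 2 * R) :
    ENNReal.ofReal (Real.exp (-lam * 2 ^ h * weightedCount (leB · y) ls)) ≤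
      pot y (S.lower I lam R i) h ls := by
  induction ls generalizing h with
  | nil => simp [weightedCount, pot]
  | cons l ls ih =>
    have h1 := S.le_exponent (R := R) hlam hi (-1) h l.ctr (l.buf.countP (leB · y))
    rw [weightedCount] at hls
    push_cast at hls
    have hp : (0 : ℝ) < 2 ^ h := by positivity
    have hov : ¬ S.Overfull R i h (l.buf.countP (leB · y)) := by
      rintro ⟨h2, -⟩
      have : (0 : ℝ) ≤ weightedCount (leB · y) ls := Nat.cast_nonneg _
      nlinarith
    have hls' : 2 ^ (h + 1) * (weightedCount (leB · y) ls : ℝ) < 2 * R := by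
      have : (0 : ℝ) ≤ l.buf.countP (leB · y) := Nat.cast_nonneg _
      rw [pow_succ]
      nlinarith
    rw [pot, Schedule.lower, if_neg hov]
    refine le_trans (le_of_eq ?_) (mul_le_mul' (Schedule.ofReal_exp_mono h1) (ih (h + 1) hls'))
    rw [← Schedule.ofReal_exp_add, weightedCount]
    push_cast
    congr 2
    ring

theorem prob_le_ofReal_exp {p : PMF α} {E : Set α} {x z : ℝ}
    (h : ENNReal.ofReal (Real.exp x) * prob p E ≤ ENNReal.ofReal (Real.exp z)) :
    prob p E ≤ ENNReal.ofReal (Real.exp (z - x)) := by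
  calc prob p E = ENNReal.ofReal (Real.exp (-x)) * (ENNReal.ofReal (Real.exp x) * prob p E) := by
        rw [← mul_assoc, ← Schedule.ofReal_exp_add]; simp
    _ ≤ ENNReal.ofReal (Real.exp (-x)) * ENNReal.ofReal (Real.exp z) := by gcongr
    _ = _ := by rw [← Schedule.ofReal_exp_add]; congr 2; ring

theorem itemFactor_pow_rank_le (hlam : 0 ≤ lam) (hR : 0 ≤ R) {η : ℝ}
    (hsum : S.totalShare I lam R ≤ η) (σ : ℝ) {r : ℕ} (hr : (r : ℝ) = R) :
    S.itemFactor I lam R σ 0 0 ^ r ≤ ENNReal.ofReal (Real.exp (σ * lam * R + lam * η * R)) := by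
  rw [Schedule.itemFactor_pow, hr]
  refine Schedule.ofReal_exp_mono ?_
  have h1 := S.surplus_le (I := I) hlam hR 0 0
  rw [pow_zero, mul_one] at h1 ⊢
  have h2 := mul_le_mul_of_nonneg_right
    (h1.trans (mul_le_mul_of_nonneg_left hsum hlam)) hR
  rw [add_mul]
  linarith

/-- The tail bound for the error of the sketch. -/
theorem prob_error_le (hS : S.Regular) (t : History U) (y : U) (hlam : 0 ≤ lam)
    {ε : ℝ} (hε : 0 < ε) (hε1 : ε ≤ 1) (hpos : 0 < t.rank y)
    (hsum : S.totalShare (S.cls t.card) lam (t.rank y) ≤ ε / 2) :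
    prob (runState S t) {s | ε * t.rank y ≤
      |((weightedCount (leB · y) s.levels : ℕ) : ℝ) - t.rank y|} ≤
      2 * ENNReal.ofReal (Real.exp (-(lam * ε * t.rank y / 2))) := by
  obtain ⟨R, hR⟩ : ∃ R : ℝ, (t.rank y : ℝ) = R := ⟨_, rfl⟩
  obtain ⟨I, hI⟩ : ∃ I, S.cls t.card = I := ⟨_, rfl⟩
  have hR0 : 0 < R := by rw [← hR]; exact_mod_cast hpos
  rw [hR, hI] at hsum
  rw [hR]
  have hsum1 : S.totalShare I lam R ≤ 1 := by linarith
  set W : State U → ℝ := fun s => ((weightedCount (leB · y) s.levels : ℕ) : ℝ) with hW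
  have hup := (Schedule.isPotential_upper hS hlam hR0.le hsum1).expect_runState_le y hS t hI.le
  have hlo := (Schedule.isPotential_lower hS hlam hR0.le hsum1).expect_runState_le y hS t hI.le
  -- on the support, the stored count is the true one, and the class is known
  have h1 : prob (runState S t) {s | s ∈ (runState S t).support ∧ (1 + ε) * R ≤ W s} ≤
      ENNReal.ofReal (Real.exp (-(lam * ε * R / 2))) := by
    have h2 : ENNReal.ofReal (Real.exp (lam * ((1 + ε) * R))) *
        prob (runState S t) {s | s ∈ (runState S t).support ∧ (1 + ε) * R ≤ W s} ≤
        ENNReal.ofReal (Real.exp (1 * lam * R + lam * (ε / 2) * R)) := by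
      refine (mul_prob_le_expect fun s hs => ?_).trans
        (hup.trans (itemFactor_pow_rank_le hlam hR0.le hsum 1 hR))
      have hc : S.cls s.count ≤ I := by rw [(invariant_runState hS t hs.1).count_eq, hI]
      refine le_min (Schedule.ofReal_exp_mono ?_)
        (le_trans (Schedule.ofReal_exp_mono ?_) (ofReal_exp_le_pot_upper hlam hc y 0 s.levels))
      · have : lam * ((1 + ε) * R) ≤ lam * (2 * R) := by gcongr; linarith
        linarith
      · rw [pow_zero, mul_one]
        exact mul_le_mul_of_nonneg_left hs.2 hlam
    refine (prob_le_ofReal_exp h2).trans_eq ?_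
    congr 2
    ring
  have h2 : prob (runState S t) {s | s ∈ (runState S t).support ∧ W s ≤ (1 - ε) * R} ≤
      ENNReal.ofReal (Real.exp (-(lam * ε * R / 2))) := by
    have h2 : ENNReal.ofReal (Real.exp (-lam * ((1 - ε) * R))) *
        prob (runState S t) {s | s ∈ (runState S t).support ∧ W s ≤ (1 - ε) * R} ≤
        ENNReal.ofReal (Real.exp (-1 * lam * R + lam * (ε / 2) * R)) := by
      refine (mul_prob_le_expect fun s hs => ?_).trans
        (hlo.trans (itemFactor_pow_rank_le hlam hR0.le hsum (-1) hR))
      have hc : S.cls s.count ≤ I := by rw [(invariant_runState hS t hs.1).count_eq, hI]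
      rw [min_eq_right le_top]
      refine le_trans (Schedule.ofReal_exp_mono ?_)
        (ofReal_exp_le_pot_lower hlam hc y 0 s.levels ?_)
      · rw [pow_zero, mul_one]
        exact mul_le_mul_of_nonpos_left hs.2 (by linarith)
      · rw [pow_zero, one_mul]
        refine lt_of_le_of_lt hs.2 ?_
        nlinarith
    refine (prob_le_ofReal_exp h2).trans_eq ?_
    congr 2
    ring
  rw [two_mul]
  refine le_trans ?_ ((MeasureTheory.measure_union_le (μ := (runState S t).toOuterMeasure) _ _).trans
    (add_le_add h1 h2))
  refine PMF.toOuterMeasure_mono _ ?_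
  rintro s ⟨hs, hsupp⟩
  simp only [Set.mem_ofPred_eq] at hs
  rcases le_abs.1 hs with h | h
  · exact Or.inl ⟨hsupp, by simp only [hW]; linarith⟩
  · exact Or.inr ⟨hsupp, by simp only [hW]; linarith⟩

end

/-! ### The choice of the schedule -/

/-- The parameter `√(log (1 / δ)) / ε`. -/
noncomputable def quality (ε δ : ℝ) : ℝ := √(Real.logb 2 (1 / δ)) / ε

/-- The schedule of the sketch. Class `i` is for summaries with `ε n ≤ 2 ^ 4 ^ i`. The number of
sections and the square of their width have a product that grows quadratically with `i`, so that the
variances of all the classes have a bounded sum. -/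
noncomputable def schedule (ε δ : ℝ) : Schedule where
  cls n := Nat.clog 4 (Nat.clog 2 ⌈ε * n⌉₊)
  width i := ⌈8 * (i + 1) * quality ε δ / 2 ^ i⌉₊

theorem mul_le_two_pow_cls (ε δ : ℝ) (n : ℕ) :
    ε * n ≤ 2 ^ 4 ^ (schedule ε δ).cls n := by
  have h1 : ⌈ε * n⌉₊ ≤ 2 ^ 4 ^ (schedule ε δ).cls n :=
    (Nat.le_pow_clog (by norm_num) _).trans
      (Nat.pow_le_pow_right (by norm_num) (Nat.le_pow_clog (by norm_num) _))
  calc ε * n ≤ ⌈ε * n⌉₊ := Nat.le_ceil _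
    _ ≤ _ := by exact_mod_cast h1

section

variable {ε δ : ℝ} (hε : 0 < ε) (hε1 : ε ≤ 1) (hδ : 0 < δ) (hδ2 : δ ≤ 1 / 2)

include hδ hδ2 in
theorem one_le_logb : 1 ≤ Real.logb 2 (1 / δ) := by
  rw [Real.le_logb_iff_rpow_le (by norm_num) (by positivity), Real.rpow_one, le_div_iff₀ hδ]
  linarith

include hε hδ hδ2 in
theorem inv_le_quality : 1 / ε ≤ quality ε δ := by
  unfold quality
  gcongr
  exact Real.one_le_sqrt.2 (one_le_logb hδ hδ2)

include hε hδ hδ2 in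
theorem quality_pos : 0 < quality ε δ :=
  lt_of_lt_of_le (by positivity) (inv_le_quality hε hδ hδ2)

include hε hδ hδ2 in
theorem width_pos (i : ℕ) : 0 < (schedule ε δ).width i := by
  have := quality_pos hε hδ hδ2
  exact Nat.ceil_pos.2 (by positivity)

theorem le_width (ε δ : ℝ) (i : ℕ) :
    8 * (i + 1) * quality ε δ / 2 ^ i ≤ (schedule ε δ).width i := Nat.le_ceil _

include hε hδ hδ2 in
theorem width_lt (i : ℕ) :
    ((schedule ε δ).width i : ℝ) < 8 * (i + 1) * quality ε δ / 2 ^ i + 1 := by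
  have := quality_pos hε hδ hδ2
  exact Nat.ceil_lt_add_one (by positivity)

include hε hδ hδ2 in
theorem regular_schedule : (schedule ε δ).Regular where
  cls_mono := by
    intro n m hnm
    refine Nat.clog_mono_right _ (Nat.clog_mono_right _ (Nat.ceil_le_ceil ?_))
    gcongr
  width_pos := width_pos hε hδ hδ2
  width_anti := by
    have hq := quality_pos hε hδ hδ2
    refine antitone_nat_of_succ_le fun i => Nat.ceil_le_ceil ?_
    rw [div_le_div_iff₀ (by positivity) (by positivity), pow_succ]
    push_cast
    have : 0 ≤ 8 * quality ε δ * 2 ^ i := by positivity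
    nlinarith [this, mul_nonneg this (Nat.cast_nonneg (α := ℝ) i)]
  prot_mono := by
    have hq := quality_pos hε hδ hδ2
    refine monotone_nat_of_le_succ fun i => ?_
    have h1 : (schedule ε δ).width i ≤ 2 * (schedule ε δ).width (i + 1) := by
      refine Nat.ceil_le.2 ?_
      have h2 := le_width ε δ (i + 1)
      have h3 : 8 * ((i : ℝ) + 1) * quality ε δ / 2 ^ i ≤
          2 * (8 * ((i + 1 : ℕ) + 1) * quality ε δ / 2 ^ (i + 1)) := by
        rw [pow_succ, mul_div_assoc', div_le_div_iff₀ (by positivity) (by positivity)]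
        push_cast
        have : 0 ≤ 8 * quality ε δ * 2 ^ i := by positivity
        nlinarith
      push_cast at h2 h3 ⊢
      linarith
    unfold Schedule.prot Schedule.numSec Schedule.sec
    rw [pow_succ]
    have := Nat.mul_le_mul_left (4 ^ i) h1
    nlinarith [Nat.zero_le (4 ^ i)]
  ctr_lt := by
    intro n C hC
    set i := (schedule ε δ).cls n with hi
    have hq := inv_le_quality hε hδ hδ2
    have h1 : ε * n ≤ 2 ^ 4 ^ i := mul_le_two_pow_cls ε δ n
    have h2 : 1 / (ε * 2 ^ i) ≤ ((schedule ε δ).sec i : ℝ) := by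
      have h3 := le_width ε δ i
      have h4 : 1 / (ε * 2 ^ i) ≤ 8 * (i + 1) * quality ε δ / 2 ^ i := by
        rw [← div_div]
        gcongr
        have : (0 : ℝ) ≤ i := Nat.cast_nonneg i
        have h5 := quality_pos hε hδ hδ2
        nlinarith
      unfold Schedule.sec
      push_cast
      linarith
    have h3 : (C : ℝ) ≤ 2 ^ (4 ^ i + i) := by
      have h4 : ((schedule ε δ).sec i : ℝ) * C ≤ n := by exact_mod_cast hC
      have h5 : 1 / (ε * 2 ^ i) * C ≤ n := le_trans (by gcongr) h4
      rw [one_div, inv_mul_le_iff₀ (by positivity)] at h5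
      rw [pow_add]
      calc (C : ℝ) ≤ ε * 2 ^ i * n := h5
        _ = (ε * n) * 2 ^ i := by ring
        _ ≤ _ := by gcongr
    have h4 : C ≤ 2 ^ (4 ^ i + i) := by exact_mod_cast h3
    have h5 : i < 4 ^ i := Nat.lt_pow_self (by norm_num)
    have h6 : 1 ≤ 2 ^ (4 ^ i + i) := Nat.one_le_two_pow
    have h7 : 2 ^ (4 ^ i + i + 1) < 2 ^ Schedule.numSec i := by
      refine Nat.pow_lt_pow_right (by norm_num) ?_
      unfold Schedule.numSec
      rcases Nat.eq_zero_or_pos i with h0 | h0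
      · rw [h0]; norm_num
      · omega
    rw [pow_succ] at h7
    omega

/-- Partial sums of the inverse squares. -/
theorem sum_inv_sq_le (m : ℕ) :
    ∑ j ∈ Finset.range (m + 1), 1 / ((j : ℝ) + 1) ^ 2 ≤ 2 - 1 / ((m : ℝ) + 1) := by
  induction m with
  | zero => norm_num
  | succ m ih =>
    rw [Finset.sum_range_succ]
    push_cast
    have h1 : 1 / ((m : ℝ) + 1 + 1) ^ 2 ≤ 1 / (m + 1) - 1 / (m + 1 + 1) := by
      rw [div_sub_div _ _ (by positivity) (by positivity), div_le_div_iff₀ (by positivity)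
        (by positivity)]
      nlinarith [Nat.cast_nonneg (α := ℝ) m]
    linarith

include hε hδ hδ2 in
/-- The surpluses of all the classes together are a small fraction of the weights. -/
theorem totalShare_le (I : ℕ) {R : ℝ} (hR : 0 < R) :
    (schedule ε δ).totalShare I (4 * Real.logb 2 (1 / δ) / (ε * R)) R ≤ ε / 2 := by
  have hq := quality_pos hε hδ hδ2
  have hl := one_le_logb hδ hδ2
  set l := Real.logb 2 (1 / δ) with hldef
  have hq2 : quality ε δ ^ 2 = l / ε ^ 2 := by
    rw [quality, div_pow, Real.sq_sqrt (by linarith)]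
  have h1 : ∀ j : ℕ, 8 * (4 * l / (ε * R)) * R /
      ((schedule ε δ).width j * (schedule ε δ).prot j) ≤ ε / 4 * (1 / ((j : ℝ) + 1) ^ 2) := by
    intro j
    set w : ℝ := ((schedule ε δ).width j : ℝ) with hw
    have hw0 : 0 < w := by rw [hw]; exact_mod_cast width_pos hε hδ hδ2 j
    have hP : 9 * 4 ^ j * w ≤ (schedule ε δ).prot j := by
      unfold Schedule.prot Schedule.numSec Schedule.sec
      push_cast
      rw [← hw]
      have : (0 : ℝ) < 4 ^ j := by positivity
      nlinarith
    have hw2 : 64 * (j + 1) ^ 2 * (l / ε ^ 2) ≤ 4 ^ j * w ^ 2 := by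
      have h2 := le_width ε δ j
      rw [div_le_iff₀ (by positivity), ← hw] at h2
      have h3 := pow_le_pow_left₀ (by positivity) h2 2
      rw [← hq2]
      have h4 : (4 : ℝ) ^ j = (2 ^ j) ^ 2 := by rw [← pow_mul, mul_comm, pow_mul]; norm_num
      rw [h4]
      nlinarith
    have hwP : 576 * (j + 1) ^ 2 * (l / ε ^ 2) ≤ w * (schedule ε δ).prot j := by
      nlinarith
    have e1 : 8 * (4 * l / (ε * R)) * R = 32 * l / ε := by
      field_simp
      ring
    have hj : (0 : ℝ) < (j + 1) ^ 2 := by positivity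
    rw [e1]
    calc 32 * l / ε / (w * (schedule ε δ).prot j)
        ≤ 32 * l / ε / (576 * (j + 1) ^ 2 * (l / ε ^ 2)) := by gcongr
      _ = ε / 18 * (1 / ((j : ℝ) + 1) ^ 2) := by
        field_simp
        ring
      _ ≤ _ := by gcongr; norm_num
  calc (schedule ε δ).totalShare I (4 * l / (ε * R)) R
      ≤ ∑ j ∈ Finset.range (I + 1), ε / 4 * (1 / ((j : ℝ) + 1) ^ 2) :=
        Finset.sum_le_sum fun j _ => h1 j
    _ = ε / 4 * ∑ j ∈ Finset.range (I + 1), 1 / ((j : ℝ) + 1) ^ 2 := by rw [Finset.mul_sum]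
    _ ≤ ε / 4 * 2 := by
        gcongr
        refine (sum_inv_sq_le I).trans ?_
        have : (0 : ℝ) ≤ 1 / (I + 1) := by positivity
        linarith
    _ = ε / 2 := by ring

include hδ hδ2 in
theorem two_mul_exp_lt : 2 * Real.exp (-(2 * Real.logb 2 (1 / δ))) < δ := by
  have hlog2 : 0 < Real.log 2 := Real.log_pos (by norm_num)
  have h1 : Real.log 2 < 1 := Real.log_two_lt_d9.trans (by norm_num)
  have hlog : Real.log 2 ≤ -Real.log δ := by
    rw [← Real.log_inv]
    refine Real.log_le_log (by norm_num) ?_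
    rw [le_inv_comm₀ (by norm_num) hδ]
    linarith
  have h2 : Real.logb 2 (1 / δ) = -Real.log δ / Real.log 2 := by
    rw [Real.logb, one_div, Real.log_inv]
  have h3 : -Real.log δ < Real.logb 2 (1 / δ) := by
    rw [h2, lt_div_iff₀ hlog2]
    nlinarith
  calc 2 * Real.exp (-(2 * Real.logb 2 (1 / δ)))
      = Real.exp (Real.log 2 - 2 * Real.logb 2 (1 / δ)) := by
        rw [sub_eq_add_neg, Real.exp_add, Real.exp_log (by norm_num)]
    _ < Real.exp (Real.log δ) := Real.exp_lt_exp.2 (by linarith)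
    _ = δ := Real.exp_log hδ

end

/-! ### Size and integers -/

theorem length_items_le {m : ℕ} (s : State α) (h : ∀ l ∈ s.levels, l.buf.length ≤ m) :
    s.items.length ≤ s.levels.length * m := by
  obtain ⟨n, ls⟩ := s
  simp only [State.items] at *
  induction ls with
  | nil => simp
  | cons l ls ih =>
    rw [List.forall_mem_cons] at h
    have := ih h.2
    rw [List.flatMap_cons, List.length_append, List.length_cons, add_mul]
    omega

theorem length_ints (s : State α) : s.ints.length = 1 + 2 * s.levels.length := by
  obtain ⟨n, ls⟩ := s
  simp only [State.ints, List.length_cons]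
  induction ls with
  | nil => simp
  | cons l ls ih =>
    rw [List.flatMap_cons, List.length_append, List.length_cons]
    simp only [List.length_cons, List.length_nil]
    omega

theorem length_le_weight (ls : List (Compactor α)) : ∀ l ∈ ls, l.buf.length ≤ weight ls := by
  induction ls with
  | nil => simp
  | cons l ls ih =>
    rw [List.forall_mem_cons, weight_cons]
    exact ⟨by omega, fun l' hl' => (ih l' hl').trans (by omega)⟩

theorem Invariant.le_of_mem_ints {S : Schedule} {n : ℕ} {s : State α} (h : Invariant S n s) :
    ∀ w ∈ s.ints, w ≤ n := by
  intro w hw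
  rw [State.ints, List.mem_cons, List.mem_flatMap] at hw
  rcases hw with rfl | ⟨l, hl, hw⟩
  · exact h.count_eq.le
  · simp only [List.mem_cons, List.not_mem_nil, or_false] at hw
    rw [← h.weight_eq]
    rcases hw with rfl | rfl
    · have h1 : 0 < S.sec (S.cls n) := Nat.succ_pos _
      exact (Nat.le_mul_of_pos_left _ h1).trans (h.ctr.mul_ctr_le l hl)
    · exact length_le_weight _ l hl

theorem size_le_logb {w n : ℕ} (h : w ≤ n) : (Nat.size w : ℝ) ≤ 2 * Real.logb 2 (n + 2) := by
  have hn : (0 : ℝ) ≤ n := Nat.cast_nonneg n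
  have h1 : 1 ≤ Real.logb 2 (n + 2) := by
    rw [Real.le_logb_iff_rpow_le (by norm_num) (by positivity), Real.rpow_one]
    linarith
  rcases Nat.eq_zero_or_pos (Nat.size w) with h0 | h0
  · rw [h0, Nat.cast_zero]
    linarith
  · have h2 : 2 ^ (Nat.size w - 1) ≤ w := Nat.lt_size.1 (by omega)
    have h3 : ((Nat.size w - 1 : ℕ) : ℝ) ≤ Real.logb 2 (n + 2) := by
      rw [Real.le_logb_iff_rpow_le (by norm_num) (by positivity), Real.rpow_natCast]
      have : ((2 ^ (Nat.size w - 1) : ℕ) : ℝ) ≤ n := by exact_mod_cast h2.trans h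
      push_cast at this
      linarith
    rw [Nat.cast_sub h0, Nat.cast_one] at h3
    linarith

section

variable (ε : ℝ) (n : ℕ)

theorem two_le_lg : 2 ≤ lg ε n := by
  unfold lg
  rw [Real.le_logb_iff_rpow_le (by norm_num) (by positivity)]
  norm_num

theorem one_le_lglg : 1 ≤ lglg ε n := by
  have := two_le_lg ε n
  unfold lglg
  rwa [Real.le_logb_iff_rpow_le (by norm_num) (by linarith), Real.rpow_one]

variable {ε n}

theorem le_lg_of_two_pow_le {m : ℕ} (h : (2 : ℝ) ^ m ≤ ε * n + 1) : (m : ℝ) ≤ lg ε n + 1 := by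
  have h1 : (0 : ℝ) < max (ε * n) 4 := by positivity
  rw [← sub_le_iff_le_add]
  unfold lg
  rw [Real.le_logb_iff_rpow_le (by norm_num) h1, Real.rpow_sub_one (by norm_num),
    Real.rpow_natCast, div_le_iff₀ (by norm_num)]
  have h2 := le_max_left (ε * n) 4
  have h3 := le_max_right (ε * n) 4
  linarith

theorem four_pow_cls_le (hε : 0 < ε) (δ : ℝ) : (4 : ℝ) ^ (schedule ε δ).cls n ≤ 8 * lg ε n := by
  have hL := two_le_lg ε n
  have hi : (schedule ε δ).cls n = Nat.clog 4 (Nat.clog 2 ⌈ε * n⌉₊) := rfl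
  set m := ⌈ε * n⌉₊ with hm
  set l := Nat.clog 2 m with hl
  set i := (schedule ε δ).cls n with hidef
  rcases Nat.eq_zero_or_pos i with h0 | h0
  · rw [h0, pow_zero]
    linarith
  have hl1 : 1 < l := by
    by_contra hle
    rw [Nat.clog_of_right_le_one (by omega)] at hi
    omega
  have hm1 : 1 < m := by
    by_contra hle
    rw [Nat.clog_of_right_le_one (by omega)] at hl
    omega
  have h1 : 4 ^ (i - 1) < l := by
    have := Nat.pow_pred_clog_lt_self (b := 4) (by norm_num) hl1
    rwa [← hi, Nat.pred_eq_sub_one] at this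
  have h2 : 2 ^ (l - 1) < m := by
    have := Nat.pow_pred_clog_lt_self (b := 2) (by norm_num) hm1
    rwa [← hl, Nat.pred_eq_sub_one] at this
  have h3 : ((l - 1 : ℕ) : ℝ) ≤ lg ε n + 1 := by
    refine le_lg_of_two_pow_le ?_
    have h4 : (m : ℝ) < ε * n + 1 := Nat.ceil_lt_add_one (by positivity)
    have h5 : ((2 ^ (l - 1) : ℕ) : ℝ) < m := by exact_mod_cast h2
    push_cast at h5
    linarith
  rw [Nat.cast_sub hl1.le, Nat.cast_one] at h3
  have h6 : ((4 ^ (i - 1) : ℕ) : ℝ) < l := by exact_mod_cast h1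
  push_cast at h6
  have h7 : (4 : ℝ) ^ i = 4 * 4 ^ (i - 1) := by
    conv_lhs => rw [show i = i - 1 + 1 by omega, pow_succ]
    ring
  rw [h7]
  linarith

theorem two_pow_cls_le (hε : 0 < ε) (δ : ℝ) :
    (2 : ℝ) ^ (schedule ε δ).cls n ≤ 3 * √(lg ε n) := by
  have h1 := four_pow_cls_le (n := n) hε δ
  have hL := two_le_lg ε n
  refine (pow_le_pow_iff_left₀ (by positivity) (by positivity) two_ne_zero).1 ?_
  rw [mul_pow, Real.sq_sqrt (by linarith), ← pow_mul, mul_comm _ 2, pow_mul]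
  norm_num
  linarith

theorem cls_add_one_le (hε : 0 < ε) (δ : ℝ) :
    ((schedule ε δ).cls n : ℝ) + 1 ≤ 3 * lglg ε n := by
  have h1 := four_pow_cls_le (n := n) hε δ
  have hL := two_le_lg ε n
  have hLL := one_le_lglg ε n
  have h2 : 2 * ((schedule ε δ).cls n : ℝ) ≤ 3 + lglg ε n := by
    have h3 : Real.logb 2 (8 * lg ε n) = 3 + lglg ε n := by
      rw [Real.logb_mul (by norm_num) (by linarith), lglg,
        show (8 : ℝ) = 2 ^ (3 : ℝ) by norm_num, Real.logb_rpow (by norm_num) (by norm_num)]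
    rw [← h3, Real.le_logb_iff_rpow_le (by norm_num) (by linarith)]
    refine le_trans (le_of_eq ?_) h1
    rw [Real.rpow_mul (by norm_num), Real.rpow_natCast]
    norm_num
  linarith

variable {δ : ℝ} (hε : 0 < ε) (hδ : 0 < δ) (hδ2 : δ ≤ 1 / 2)
include hε hδ hδ2

theorem cap_cls_le : ((schedule ε δ).cap ((schedule ε δ).cls n) : ℝ) ≤
    864 * (lglg ε n * √(lg ε n) * quality ε δ) + 192 * lg ε n := by
  have h4 := four_pow_cls_le (n := n) hε δ
  have h2 := two_pow_cls_le (n := n) hε δ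
  have h1 := cls_add_one_le (n := n) hε δ
  have hLL := one_le_lglg ε n
  have hq := quality_pos hε hδ hδ2
  set i := (schedule ε δ).cls n
  have hw := width_lt hε hδ hδ2 i
  have h5 : ((schedule ε δ).cap i : ℝ) = 12 * 4 ^ i * ((schedule ε δ).width i + 1) := by
    unfold Schedule.cap Schedule.prot Schedule.numSec Schedule.sec
    push_cast
    ring
  have h6 : (4 : ℝ) ^ i = 2 ^ i * 2 ^ i := by rw [← mul_pow]; norm_num
  calc ((schedule ε δ).cap i : ℝ)
      ≤ 12 * 4 ^ i * (8 * (i + 1) * quality ε δ / 2 ^ i + 1 + 1) := by rw [h5]; gcongr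
    _ = 96 * ((i + 1) * 2 ^ i * quality ε δ) + 24 * 4 ^ i := by
        rw [h6]
        field_simp
        ring
    _ ≤ 96 * ((3 * lglg ε n) * (3 * √(lg ε n)) * quality ε δ) + 24 * (8 * lg ε n) := by
        gcongr
    _ = _ := by ring

theorem length_levels_le {s : State α} (h : Invariant (schedule ε δ) n s) :
    (s.levels.length : ℝ) ≤ 2 * lg ε n := by
  have hL := two_le_lg ε n
  have h1 := h.full.two_pow_mul_le
  rw [h.weight_eq] at h1
  have hP : 1 / ε ≤ (schedule ε δ).prot 0 := by
    refine (inv_le_quality hε hδ hδ2).trans ?_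
    have h2 := le_width ε δ 0
    have hq := quality_pos hε hδ hδ2
    unfold Schedule.prot Schedule.numSec Schedule.sec
    push_cast at h2 ⊢
    norm_num at h2 ⊢
    linarith
  have hP0 := (schedule ε δ).prot_pos 0
  have h2 : (2 : ℝ) ^ (s.levels.length - 1) ≤ ε * n + 1 := by
    have h3 : (2 : ℝ) ^ (s.levels.length - 1) * (schedule ε δ).prot 0 ≤
        n + (schedule ε δ).prot 0 := by exact_mod_cast h1
    have h4 : (n : ℝ) ≤ ε * n * (schedule ε δ).prot 0 := by
      rw [div_le_iff₀ hε] at hP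
      nlinarith [Nat.cast_nonneg (α := ℝ) n]
    refine le_of_mul_le_mul_right ?_ hP0
    linarith
  have h3 := le_lg_of_two_pow_le h2
  have h4 : (s.levels.length : ℝ) ≤ ((s.levels.length - 1 : ℕ) : ℝ) + 1 := by
    exact_mod_cast (by omega : s.levels.length ≤ s.levels.length - 1 + 1)
  linarith

/-- The size of a summary; the first term dominates for small `ε`, the second one for large `ε`. -/
theorem size_le {s : State α} (h : Invariant (schedule ε δ) n s) :
    (s.toSummary.size : ℝ) ≤ 1728 * (1 / ε * lg ε n ^ (3 / 2 : ℝ) *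
      √(Real.logb 2 (1 / δ)) * lglg ε n) + 400 * lg ε n ^ 2 := by
  have hL := two_le_lg ε n
  have hLL := one_le_lglg ε n
  have hq := quality_pos hε hδ hδ2
  have h1 := length_levels_le hε hδ hδ2 h
  have h2 := cap_cls_le (n := n) hε hδ hδ2
  have h3 : (s.items.length : ℝ) ≤ s.levels.length *
      (schedule ε δ).cap ((schedule ε δ).cls n) := by exact_mod_cast length_items_le s h.cap
  have h4 : (s.ints.length : ℝ) = 1 + 2 * s.levels.length := by exact_mod_cast length_ints s
  have h5 : (s.toSummary.size : ℝ) = s.items.length + s.ints.length := by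
    simp [Summary.size, State.toSummary]
  have h6 : lg ε n ^ (3 / 2 : ℝ) = lg ε n * √(lg ε n) := by
    rw [Real.sqrt_eq_rpow, ← Real.rpow_one_add' (by linarith) (by norm_num)]
    norm_num
  have h7 : (s.levels.length : ℝ) * (schedule ε δ).cap ((schedule ε δ).cls n) ≤
      2 * lg ε n * (864 * (lglg ε n * √(lg ε n) * quality ε δ) + 192 * lg ε n) := by
    gcongr
  have h8 : 1728 * (1 / ε * lg ε n ^ (3 / 2 : ℝ) * √(Real.logb 2 (1 / δ)) * lglg ε n) =
      2 * lg ε n * (864 * (lglg ε n * √(lg ε n) * quality ε δ)) := by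
    rw [h6, quality]
    ring
  rw [h8, h5, h4]
  nlinarith

end

theorem prob_sketchOf_run {U : Type*} [LinearOrder U] (S : Schedule) (t : History U) (y : U)
    (E : Set ℝ) :
    prob ((sketchOf S).run t) {s | (sketchOf S).estimateRank s y ∈ E} =
      prob (runState S t) {s | ((weightedCount (leB · y) s.levels : ℕ) : ℝ) ∈ E} := by
  rw [run_eq_map_runState, prob, PMF.toOuterMeasure_map_apply, prob]
  congr 1
  ext s
  simp only [Set.mem_preimage, Set.mem_ofPred_eq, estimateRank_toSummary]

/-- The accuracy of the sketch for positive ranks. -/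
theorem prob_sketchOf_schedule_lt {U : Type*} [LinearOrder U] {ε δ : ℝ} (hε : 0 < ε)
    (hε1 : ε ≤ 1) (hδ : 0 < δ) (hδ2 : δ ≤ 1 / 2) (t : History U) (y : U) (hpos : 0 < t.rank y) :
    prob ((sketchOf (schedule ε δ)).run t) {s | ε * t.rank y ≤
      |(sketchOf (schedule ε δ)).estimateRank s y - t.rank y|} < ENNReal.ofReal δ := by
  have hR : (0 : ℝ) < t.rank y := by exact_mod_cast hpos
  have hl := one_le_logb hδ hδ2
  refine lt_of_eq_of_lt (prob_sketchOf_run (schedule ε δ) t y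
    {x | ε * t.rank y ≤ |x - t.rank y|}) ?_
  refine lt_of_le_of_lt (prob_error_le (regular_schedule hε hδ hδ2) t y
    (lam := 4 * Real.logb 2 (1 / δ) / (ε * t.rank y)) (by positivity) hε hε1 hpos
    (totalShare_le hε hδ hδ2 _ hR)) ?_
  have h1 : 4 * Real.logb 2 (1 / δ) / (ε * t.rank y) * ε * t.rank y / 2 =
      2 * Real.logb 2 (1 / δ) := by
    field_simp
    ring
  rw [h1, ← ENNReal.ofReal_ofNat, ← ENNReal.ofReal_mul (by norm_num)]
  exact (ENNReal.ofReal_lt_ofReal_iff hδ).2 (two_mul_exp_lt hδ hδ2)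

theorem prob_sketchOf_eq_zero {U : Type*} [LinearOrder U] (S : Schedule) (ε : ℝ) (t : History U)
    (y : U) (h0 : t.rank y = 0) :
    prob ((sketchOf S).run t) {s | ε * t.rank y <
      |(sketchOf S).estimateRank s y - t.rank y|} = 0 := by
  refine (prob_sketchOf_run S t y {x | ε * t.rank y < |x - t.rank y|}).trans ?_
  rw [prob, PMF.toOuterMeasure_apply_eq_zero_iff, Set.disjoint_left]
  intro s hs hE
  simp [weightedCount_eq_zero_of_rank_eq_zero t hs h0, h0] at hE

end RelQuantile

theorem mainTheorem6 :
    ∃ A : ℝ → ℝ → RelQuantile.Sketch,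
      -- accuracy, for every fixed query item and every sequence of insertions and merges
      (∀ (ε δ : ℝ) (U : Type u) [LinearOrder U] (t : RelQuantile.History U),
        RelQuantile.Admissible ε δ t.card → ∀ y : U,
          (0 < t.rank y →
            RelQuantile.prob ((A ε δ).run t)
              {s | ε * t.rank y ≤ |(A ε δ).estimateRank s y - t.rank y|} < ENNReal.ofReal δ) ∧
          RelQuantile.prob ((A ε δ).run t)
            {s | ε * t.rank y < |(A ε δ).estimateRank s y - t.rank y|} < ENNReal.ofReal δ) ∧
      -- every stored integer has `O(log n)` bits, so that it fits into a memory word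
      (∃ K : ℝ, ∀ (ε δ : ℝ) (U : Type u) [LinearOrder U] (t : RelQuantile.History U),
        RelQuantile.Admissible ε δ t.card → ∀ s ∈ ((A ε δ).run t).support, ∀ w ∈ s.ints,
          (Nat.size w : ℝ) ≤ K * Real.logb 2 (t.card + 2)) ∧
      -- the size, whatever constant is meant by the `O` in the case distinction
      (∀ c : ℝ, 0 < c → ∃ C : ℝ,
        ∀ (ε δ : ℝ) (U : Type u) [LinearOrder U] (t : RelQuantile.History U),
        RelQuantile.Admissible ε δ t.card → ∀ s ∈ ((A ε δ).run t).support,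
          (ε ≤ c * (RelQuantile.lglg ε t.card *
              Real.sqrt (Real.logb 2 (1 / δ) / RelQuantile.lg ε t.card)) →
            (s.size : ℝ) ≤ C * (1 / ε * RelQuantile.lg ε t.card ^ (3 / 2 : ℝ) *
              Real.sqrt (Real.logb 2 (1 / δ)) * RelQuantile.lglg ε t.card)) ∧
          (c * (RelQuantile.lglg ε t.card *
              Real.sqrt (Real.logb 2 (1 / δ) / RelQuantile.lg ε t.card)) < ε →
            (s.size : ℝ) ≤ C * RelQuantile.lg ε t.card ^ 2)) := by
  open RelQuantile in
  refine ⟨fun ε δ => sketchOf (schedule ε δ), ?_, ⟨2, ?_⟩, fun c hc =>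
    ⟨1728 + 400 * c + 1728 / c + 400, ?_⟩⟩
  · rintro ε δ U _ t ⟨hδ, hδ2, hε, hε1, -⟩ y
    refine ⟨prob_sketchOf_schedule_lt hε hε1 hδ hδ2 t y, ?_⟩
    rcases Nat.eq_zero_or_pos (t.rank y) with h0 | hpos
    · refine lt_of_eq_of_lt (prob_sketchOf_eq_zero (schedule ε δ) ε t y h0) ?_
      simpa using hδ
    · refine lt_of_le_of_lt (PMF.toOuterMeasure_mono _ ?_)
        (prob_sketchOf_schedule_lt hε hε1 hδ hδ2 t y hpos)
      rintro s ⟨hs, -⟩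
      simp only [Set.mem_ofPred_eq] at hs ⊢
      exact hs.le
  · rintro ε δ U _ t ⟨hδ, hδ2, hε, -, -⟩ s hs w hw
    simp only [run_eq_map_runState, PMF.mem_support_map_iff] at hs
    obtain ⟨s', hs', rfl⟩ := hs
    exact size_le_logb
      ((invariant_runState (regular_schedule hε hδ hδ2) t hs').le_of_mem_ints w hw)
  · rintro ε δ U _ t ⟨hδ, hδ2, hε, -, -⟩ s hs
    simp only [run_eq_map_runState, PMF.mem_support_map_iff] at hs
    obtain ⟨s', hs', rfl⟩ := hs
    have hsize := size_le hε hδ hδ2 (invariant_runState (regular_schedule hε hδ hδ2) t hs')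
    have hL := two_le_lg ε t.card
    have hLL := one_le_lglg ε t.card
    have hl := one_le_logb hδ hδ2
    set L := lg ε t.card
    set LL := lglg ε t.card
    set l := Real.logb 2 (1 / δ)
    set X := 1 / ε * L ^ (3 / 2 : ℝ) * √l * LL with hX
    have hX0 : 0 ≤ X := by positivity
    -- both cases compare `ε * X` with `ε * L ^ 2`
    have key : ε * X = L ^ 2 * (LL * √(l / L)) := by
      have h1 : L ^ (3 / 2 : ℝ) = L * √L := by
        rw [Real.sqrt_eq_rpow, ← Real.rpow_one_add' (by linarith) (by norm_num)]
        norm_num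
      have h2 : √L * √L = L := Real.mul_self_sqrt (by linarith)
      have h3 : 0 < √L := Real.sqrt_pos.2 (by linarith)
      rw [hX, h1, Real.sqrt_div (by linarith)]
      field_simp
      rw [pow_two, h2]
    refine ⟨fun h => ?_, fun h => ?_⟩
    · have h1 : L ^ 2 ≤ c * X := by
        refine le_of_mul_le_mul_left ?_ hε
        nlinarith [sq_nonneg L]
      have h2 : 0 ≤ 1728 / c * X := by positivity
      nlinarith
    · have h1 : c * X ≤ L ^ 2 := by
        refine le_of_mul_le_mul_left ?_ hε
        nlinarith [sq_nonneg L]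
      have h2 : X ≤ L ^ 2 / c := by rwa [le_div_iff₀ hc, mul_comm]
      have h3 : 1728 * (L ^ 2 / c) = 1728 / c * L ^ 2 := by ring
      have h4 : 0 ≤ c * L ^ 2 := by positivity
      nlinarith [sq_nonneg L]
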